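/- **Theorem (convergence of the Pure Greedy Algorithm).** Let $\Omega_x,\Omega_y\subset\mathbb R$ be bounded domains (non-empty, open, connected), $\Omega=\Omega_x\times\Omega_y$, and $f\in L^2(\Omega)$. Let $H^1_0$ denote the closure of $C_c^\infty$ in $H^1$, and let $H^{-1}(\Omega)$ be the dual of $H^1_0(\Omega)$; for $F\in H^{-1}(\Omega)$ and $u\in H^1_0(\Omega)$ write $\int_\Omega F\,u$ for the duality pairing, and let $\Delta u\in H^{-1}(\Omega)$ be the functional $v\mapsto-\int_\Omega\nabla u\cdot\nabla v$. For $r\in H^1_0(\Omega_x)$, $s\in H^1_0(\Omega_y)$ put $(r\otimes s)(x,y)=r(x)s(y)$, an element of $H^1_0(\Omega)$. Let $(r_n,s_n)_{n\ge1}$ be a sequence in $H^1_0(\Omega_x)\times H^1_0(\Omega_y)$, and define $f_0=f$, $f_n=f_{n-1}+\Delta(r_n\otimes s_n)$ and $$E_n=\frac12\int_\Omega|\nabla(r_n\otimes s_n)|^2-\int_\Omega f_{n-1}\,r_n\otimes s_n\qquad(n\ge1).$$ 1. Assume that for every $n\ge1$ the pair $(r_n,s_n)$ satisfies the Euler–Lagrange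 equations $$\int_\Omega\nabla(r_n\otimes s_n)\cdot\nabla(r_n\otimes s+r\otimes s_n)=\int_\Omega f_{n-1}\,(r_n\otimes s+r\otimes s_n)\quad\text{for all }(r,s)\in H^1_0(\Omega_x)\times H^1_0(\Omega_y).$$ Then both series below converge and $$\sum_{n\ge1}\int_\Omega|\nabla(r_n\otimes s_n)|^2=-2\sum_{n\ge1}E_n<\infty.$$ 2. Assume that for every $n\ge1$ the pair $(r_n,s_n)$ minimizes $$(r,s)\longmapsto\frac12\int_\Omega|\nabla(r\otimes s)|^2-\int_\Omega f_{n-1}\,r\otimes s$$ over $H^1_0(\Omega_x)\times H^1_0(\Omega_y)$. Let $g\in H^1_0(\Omega)$ be the weak solution of the Dirichlet problem $-\Delta g=f$ in $\Omega$, $g=0$ on $\partial\Omega$, and let $g_n=g-\sum_{k=1}^n r_k\otimes s_k$. Then $g_n\to0$ strongly in $H^1_0(\Omega)$, and $f_n\to0$ in $H^{-1}(\Omega)$. -/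

import Mathlib

open MeasureTheory Filter Topology Set
open scoped ContDiff

noncomputable section

namespace PureGreedy

/-- The real space `L²(A)`, with respect to Lebesgue measure on `A`. -/
abbrev L2 {E : Type*} [MeasureSpace E] (A : Set E) : Type _ :=
  Lp ℝ 2 (volume.restrict A)

/-- `φ ∈ C_c^∞(A)`: `φ` is smooth, with compact support contained in `A`. -/
def IsTestFunction {E : Type*} [NormedAddCommGroup E] [NormedSpace ℝ E] (A : Set E)
    (φ : E → ℝ) : Prop :=
  ContDiff ℝ ∞ φ ∧ HasCompactSupport φ ∧ tsupport φ ⊆ A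

section TestFunctions

variable {E : Type*} [NormedAddCommGroup E] [NormedSpace ℝ E] {A : Set E} {φ ψ : E → ℝ}

lemma IsTestFunction.zero : IsTestFunction A (0 : E → ℝ) :=
  ⟨contDiff_const, HasCompactSupport.zero, by simp [tsupport]⟩

lemma IsTestFunction.add (hφ : IsTestFunction A φ) (hψ : IsTestFunction A ψ) :
    IsTestFunction A (φ + ψ) :=
  ⟨hφ.1.add hψ.1, hφ.2.1.add hψ.2.1,
    (tsupport_add φ ψ).trans (union_subset hφ.2.2 hψ.2.2)⟩

lemma IsTestFunction.smul (c : ℝ) (hφ : IsTestFunction A φ) : IsTestFunction A (c • φ) :=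
  ⟨hφ.1.const_smul c, hφ.2.1.smul_left (f := fun _ => c),
    (tsupport_smul_subset_right (fun _ => c) φ).trans hφ.2.2⟩

lemma IsTestFunction.differentiable (hφ : IsTestFunction A φ) : Differentiable ℝ φ :=
  hφ.1.differentiable (by simp)

end TestFunctions

/-! ### The space `H¹₀` of an open subset of the line -/

/-- The pairs `(φ, φ')` with `φ ∈ C_c^∞(A)`, as elements of `L²(A) × L²(A)`. The norm of the pair
is the `H¹(A)` norm of `φ`. -/
def testGraph1 (A : Set ℝ) : Submodule ℝ (WithLp 2 (L2 A × L2 A)) where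
  carrier := {U | ∃ φ : ℝ → ℝ, IsTestFunction A φ ∧
    U.fst =ᵐ[volume.restrict A] φ ∧ U.snd =ᵐ[volume.restrict A] deriv φ}
  zero_mem' := ⟨0, IsTestFunction.zero, Lp.coeFn_zero _ _ _, by
    filter_upwards [Lp.coeFn_zero ℝ 2 (volume.restrict A)] with x hx
    have : deriv (0 : ℝ → ℝ) x = 0 := deriv_const x (0 : ℝ)
    rw [this]; exact hx⟩
  add_mem' := by
    rintro U V ⟨φ, hφ, h1, h2⟩ ⟨ψ, hψ, k1, k2⟩
    refine ⟨φ + ψ, hφ.add hψ, ?_, ?_⟩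
    · filter_upwards [h1, k1, Lp.coeFn_add U.fst V.fst] with x a b c
      exact c.trans (by simp [a, b])
    · filter_upwards [h2, k2, Lp.coeFn_add U.snd V.snd] with x a b c
      refine c.trans ?_
      rw [deriv_add (hφ.differentiable x) (hψ.differentiable x)]
      simp [a, b]
  smul_mem' := by
    rintro c U ⟨φ, hφ, h1, h2⟩
    refine ⟨c • φ, hφ.smul c, ?_, ?_⟩
    · filter_upwards [h1, Lp.coeFn_smul c U.fst] with x a b
      exact b.trans (by simp [a])
    · filter_upwards [h2, Lp.coeFn_smul c U.snd] with x a b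
      refine b.trans ?_
      rw [deriv_const_smul c (hφ.differentiable x)]
      simp [a]

/-- `H¹₀(A)` for `A ⊆ ℝ`: the closure of `C_c^∞(A)` for the `H¹` norm. A function `r ∈ H¹₀(A)` is
represented by the pair `(r, r')` of its class in `L²(A)` and that of its weak derivative. -/
def H10Line (A : Set ℝ) : Submodule ℝ (WithLp 2 (L2 A × L2 A)) :=
  (testGraph1 A).topologicalClosure

/-- The function underlying an element of `H¹₀(A)`. -/
def H10Line.val {A : Set ℝ} (r : H10Line A) : L2 A := (r : WithLp 2 (L2 A × L2 A)).fst

/-- The weak derivative of an element of `H¹₀(A)`. -/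
def H10Line.der {A : Set ℝ} (r : H10Line A) : L2 A := (r : WithLp 2 (L2 A × L2 A)).snd

/-! ### The space `H¹₀` of an open subset of the plane -/

/-- The triples `(φ, (∂ₓφ, ∂ᵧφ))` with `φ ∈ C_c^∞(Ω)`, as elements of `L²(Ω) × L²(Ω)²`. The norm of
the triple is the `H¹(Ω)` norm of `φ`. -/
def testGraph2 (Ω : Set (ℝ × ℝ)) :
    Submodule ℝ (WithLp 2 (L2 Ω × WithLp 2 (L2 Ω × L2 Ω))) where
  carrier := {U | ∃ φ : ℝ × ℝ → ℝ, IsTestFunction Ω φ ∧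
    U.fst =ᵐ[volume.restrict Ω] φ ∧
    U.snd.fst =ᵐ[volume.restrict Ω] (fun p => fderiv ℝ φ p (1, 0)) ∧
    U.snd.snd =ᵐ[volume.restrict Ω] (fun p => fderiv ℝ φ p (0, 1))}
  zero_mem' := by
    have h : ∀ p v, fderiv ℝ (0 : ℝ × ℝ → ℝ) p v = 0 := by
      intro p v
      have : fderiv ℝ (0 : ℝ × ℝ → ℝ) p = 0 := by
        rw [show (0 : ℝ × ℝ → ℝ) = fun _ => (0 : ℝ) from rfl]; simp
      simp [this]
    refine ⟨0, IsTestFunction.zero, Lp.coeFn_zero _ _ _, ?_, ?_⟩ <;>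
    · filter_upwards [Lp.coeFn_zero ℝ 2 (volume.restrict Ω)] with p hp
      rw [h]; exact hp
  add_mem' := by
    rintro U V ⟨φ, hφ, h1, h2, h3⟩ ⟨ψ, hψ, k1, k2, k3⟩
    have hd : ∀ p, fderiv ℝ (φ + ψ) p = fderiv ℝ φ p + fderiv ℝ ψ p := fun p =>
      fderiv_add (hφ.differentiable p) (hψ.differentiable p)
    refine ⟨φ + ψ, hφ.add hψ, ?_, ?_, ?_⟩
    · filter_upwards [h1, k1, Lp.coeFn_add U.fst V.fst] with x a b c
      exact c.trans (by simp [a, b])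
    · filter_upwards [h2, k2, Lp.coeFn_add U.snd.fst V.snd.fst] with x a b c
      exact c.trans (by simp [a, b, hd])
    · filter_upwards [h3, k3, Lp.coeFn_add U.snd.snd V.snd.snd] with x a b c
      exact c.trans (by simp [a, b, hd])
  smul_mem' := by
    rintro c U ⟨φ, hφ, h1, h2, h3⟩
    have hd : ∀ p, fderiv ℝ (c • φ) p = c • fderiv ℝ φ p := fun p =>
      fderiv_const_smul (hφ.differentiable p) c
    refine ⟨c • φ, hφ.smul c, ?_, ?_, ?_⟩
    · filter_upwards [h1, Lp.coeFn_smul c U.fst] with x a b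
      exact b.trans (by simp [a])
    · filter_upwards [h2, Lp.coeFn_smul c U.snd.fst] with x a b
      exact b.trans (by simp [a, hd])
    · filter_upwards [h3, Lp.coeFn_smul c U.snd.snd] with x a b
      exact b.trans (by simp [a, hd])

/-- `H¹₀(Ω)` for `Ω ⊆ ℝ²`: the closure of `C_c^∞(Ω)` for the `H¹` norm. A function `u ∈ H¹₀(Ω)` is
represented by `(u, ∇u)`, its class in `L²(Ω)` and its weak gradient in `L²(Ω)²`. The norm is
`(‖u‖² + ‖∇u‖²)^{1/2}`, with the `L²` norms on the right. -/
def H10 (Ω : Set (ℝ × ℝ)) : Submodule ℝ (WithLp 2 (L2 Ω × WithLp 2 (L2 Ω × L2 Ω))) :=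
  (testGraph2 Ω).topologicalClosure

/-- The inclusion of `H¹₀(Ω)` in `L²(Ω)`. -/
def val (Ω : Set (ℝ × ℝ)) : H10 Ω →L[ℝ] L2 Ω :=
  (WithLp.fstL 2 ℝ (L2 Ω) (WithLp 2 (L2 Ω × L2 Ω))).comp (H10 Ω).subtypeL

/-- The weak gradient `∇ : H¹₀(Ω) → L²(Ω)²`. On the target, the inner product of `(a, b)` and
`(c, d)` is `∫_Ω (a c + b d)`. -/
def grad (Ω : Set (ℝ × ℝ)) : H10 Ω →L[ℝ] WithLp 2 (L2 Ω × L2 Ω) :=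
  (WithLp.sndL 2 ℝ (L2 Ω) (WithLp 2 (L2 Ω × L2 Ω))).comp (H10 Ω).subtypeL

/-- `H⁻¹(Ω)`, the topological dual of `H¹₀(Ω)`, with the dual norm. -/
abbrev Hneg (Ω : Set (ℝ × ℝ)) : Type := StrongDual ℝ (H10 Ω)

/-- A function `f ∈ L²(Ω)` as an element of `H⁻¹(Ω)`: `v ↦ ∫_Ω f v`. -/
def ofL2 {Ω : Set (ℝ × ℝ)} (f : L2 Ω) : Hneg Ω := (innerSL ℝ f).comp (val Ω)

/-- The Laplacian `Δ u ∈ H⁻¹(Ω)` of `u ∈ H¹₀(Ω)`: `v ↦ -∫_Ω ∇u · ∇v`. -/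
def laplacian {Ω : Set (ℝ × ℝ)} (u : H10 Ω) : Hneg Ω :=
  -((innerSL ℝ (grad Ω u)).comp (grad Ω))

/-! ### Tensor products -/

section Tensor

variable {A B : Set ℝ}

lemma memLp_tensor (a : L2 A) (b : L2 B) :
    MemLp (fun p : ℝ × ℝ => a p.1 * b p.2) 2 (volume.restrict (A ×ˢ B)) := by
  rw [Measure.volume_eq_prod, ← Measure.prod_restrict]
  have hm : AEStronglyMeasurable (fun p : ℝ × ℝ => a p.1 * b p.2)
      ((volume.restrict A).prod (volume.restrict B)) :=
    (Lp.aestronglyMeasurable a).comp_fst.mul (Lp.aestronglyMeasurable b).comp_snd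
  rw [memLp_two_iff_integrable_sq hm]
  have ha := (memLp_two_iff_integrable_sq (Lp.aestronglyMeasurable a)).1 (Lp.memLp a)
  have hb := (memLp_two_iff_integrable_sq (Lp.aestronglyMeasurable b)).1 (Lp.memLp b)
  simpa [mul_pow] using ha.mul_prod hb

/-- `(a ⊗ b)(x, y) = a(x) b(y)`, for `a ∈ L²(A)` and `b ∈ L²(B)`. -/
def tensorL2 (a : L2 A) (b : L2 B) : L2 (A ×ˢ B) :=
  (memLp_tensor a b).toLp (fun p : ℝ × ℝ => a p.1 * b p.2)

lemma coeFn_tensorL2 (a : L2 A) (b : L2 B) :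
    tensorL2 a b =ᵐ[volume.restrict (A ×ˢ B)] fun p => a p.1 * b p.2 :=
  (memLp_tensor a b).coeFn_toLp

lemma ae_fst_prod {P : ℝ → Prop} (h : ∀ᵐ x ∂volume.restrict A, P x) :
    ∀ᵐ p : ℝ × ℝ ∂volume.restrict (A ×ˢ B), P p.1 := by
  rw [Measure.volume_eq_prod, ← Measure.prod_restrict]
  exact Measure.quasiMeasurePreserving_fst.ae h

lemma ae_snd_prod {P : ℝ → Prop} (h : ∀ᵐ y ∂volume.restrict B, P y) :
    ∀ᵐ p : ℝ × ℝ ∂volume.restrict (A ×ˢ B), P p.2 := by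
  rw [Measure.volume_eq_prod, ← Measure.prod_restrict]
  exact Measure.quasiMeasurePreserving_snd.ae h

lemma norm_sq_L2 {E : Type*} [MeasureSpace E] {S : Set E} (u : L2 S) :
    ‖u‖ ^ 2 = ∫ x in S, (u x) ^ 2 := by
  rw [← real_inner_self_eq_norm_sq, L2.inner_def]
  simp [sq]

lemma norm_tensorL2 (a : L2 A) (b : L2 B) : ‖tensorL2 a b‖ = ‖a‖ * ‖b‖ := by
  have h : ‖tensorL2 a b‖ ^ 2 = (‖a‖ * ‖b‖) ^ 2 := by
    rw [mul_pow, norm_sq_L2, norm_sq_L2, norm_sq_L2]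
    have : ∫ p in A ×ˢ B, (tensorL2 a b p) ^ 2 = ∫ p in A ×ˢ B, (a p.1) ^ 2 * (b p.2) ^ 2 :=
      integral_congr_ae (by filter_upwards [coeFn_tensorL2 a b] with p hp; rw [hp, mul_pow])
    rw [this, Measure.volume_eq_prod, ← Measure.prod_restrict]
    exact integral_prod_mul (fun x => (a x) ^ 2) (fun y => (b y) ^ 2)
  exact (sq_eq_sq₀ (norm_nonneg _) (by positivity)).1 h

lemma continuous_tensorL2 :
    Continuous (fun q : L2 A × L2 B => tensorL2 q.1 q.2) := by
  have hbil : ∃ T : L2 A →ₗ[ℝ] L2 B →ₗ[ℝ] L2 (A ×ˢ B), ∀ a b, T a b = tensorL2 a b := by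
    refine ⟨LinearMap.mk₂ ℝ tensorL2 ?_ ?_ ?_ ?_, fun a b => rfl⟩
    · intro a a' b
      apply Lp.ext
      filter_upwards [coeFn_tensorL2 (a + a') b, coeFn_tensorL2 a b, coeFn_tensorL2 a' b,
        Lp.coeFn_add (tensorL2 a b) (tensorL2 a' b), ae_fst_prod (Lp.coeFn_add a a')]
        with p h1 h2 h3 h4 h5
      simp only [h1, h4, Pi.add_apply, h2, h3, h5]; ring
    · intro c a b
      apply Lp.ext
      filter_upwards [coeFn_tensorL2 (c • a) b, coeFn_tensorL2 a b,
        Lp.coeFn_smul c (tensorL2 a b), ae_fst_prod (Lp.coeFn_smul c a)] with p h1 h2 h4 h5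
      simp only [h1, h4, Pi.smul_apply, h2, h5, smul_eq_mul]; ring
    · intro a b b'
      apply Lp.ext
      filter_upwards [coeFn_tensorL2 a (b + b'), coeFn_tensorL2 a b, coeFn_tensorL2 a b',
        Lp.coeFn_add (tensorL2 a b) (tensorL2 a b'), ae_snd_prod (Lp.coeFn_add b b')]
        with p h1 h2 h3 h4 h5
      simp only [h1, h4, Pi.add_apply, h2, h3, h5]; ring
    · intro c a b
      apply Lp.ext
      filter_upwards [coeFn_tensorL2 a (c • b), coeFn_tensorL2 a b,
        Lp.coeFn_smul c (tensorL2 a b), ae_snd_prod (Lp.coeFn_smul c b)] with p h1 h2 h4 h5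
      simp only [h1, h4, Pi.smul_apply, h2, h5, smul_eq_mul]; ring
  obtain ⟨T, hT⟩ := hbil
  have h := (T.mkContinuous₂ 1 (fun a b => by rw [hT, norm_tensorL2, one_mul])).continuous₂
  refine h.congr fun q => ?_
  exact hT q.1 q.2

/-- The triple `(r ⊗ s, (r' ⊗ s, r ⊗ s'))` attached to `(r, r')` and `(s, s')`. -/
def tensorGraph (U : WithLp 2 (L2 A × L2 A)) (V : WithLp 2 (L2 B × L2 B)) :
    WithLp 2 (L2 (A ×ˢ B) × WithLp 2 (L2 (A ×ˢ B) × L2 (A ×ˢ B))) :=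
  WithLp.toLp 2 (tensorL2 U.fst V.fst,
    WithLp.toLp 2 (tensorL2 U.snd V.fst, tensorL2 U.fst V.snd))

lemma continuous_tensorGraph :
    Continuous (fun q : WithLp 2 (L2 A × L2 A) × WithLp 2 (L2 B × L2 B) =>
      tensorGraph q.1 q.2) := by
  have f1 : Continuous (fun U : WithLp 2 (L2 A × L2 A) => U.fst) :=
    (WithLp.fstL 2 ℝ (L2 A) (L2 A)).continuous
  have f2 : Continuous (fun U : WithLp 2 (L2 A × L2 A) => U.snd) :=
    (WithLp.sndL 2 ℝ (L2 A) (L2 A)).continuous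
  have g1 : Continuous (fun U : WithLp 2 (L2 B × L2 B) => U.fst) :=
    (WithLp.fstL 2 ℝ (L2 B) (L2 B)).continuous
  have g2 : Continuous (fun U : WithLp 2 (L2 B × L2 B) => U.snd) :=
    (WithLp.sndL 2 ℝ (L2 B) (L2 B)).continuous
  have t := continuous_tensorL2 (A := A) (B := B)
  have h1 := t.comp ((f1.comp continuous_fst).prodMk (g1.comp continuous_snd))
  have h2 := t.comp ((f2.comp continuous_fst).prodMk (g1.comp continuous_snd))
  have h3 := t.comp ((f1.comp continuous_fst).prodMk (g2.comp continuous_snd))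
  exact (WithLp.prod_continuous_toLp 2 _ _).comp
    (h1.prodMk ((WithLp.prod_continuous_toLp 2 _ _).comp (h2.prodMk h3)))

lemma isTestFunction_tensor {φ ψ : ℝ → ℝ} (hφ : IsTestFunction A φ) (hψ : IsTestFunction B ψ) :
    IsTestFunction (A ×ˢ B) (fun p : ℝ × ℝ => φ p.1 * ψ p.2) := by
  have hsub : tsupport (fun p : ℝ × ℝ => φ p.1 * ψ p.2) ⊆ tsupport φ ×ˢ tsupport ψ := by
    refine closure_minimal ?_ ((isClosed_tsupport φ).prod (isClosed_tsupport ψ))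
    intro p hp
    have hp' : φ p.1 * ψ p.2 ≠ 0 := hp
    exact ⟨subset_tsupport φ (left_ne_zero_of_mul hp'),
      subset_tsupport ψ (right_ne_zero_of_mul hp')⟩
  refine ⟨(hφ.1.comp contDiff_fst).mul (hψ.1.comp contDiff_snd), ?_,
    hsub.trans (prod_mono hφ.2.2 hψ.2.2)⟩
  exact IsCompact.of_isClosed_subset (hφ.2.1.isCompact.prod hψ.2.1.isCompact)
    (isClosed_tsupport _) hsub

lemma tensorGraph_mem_testGraph2 {U : WithLp 2 (L2 A × L2 A)} {V : WithLp 2 (L2 B × L2 B)}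
    (hU : U ∈ testGraph1 A) (hV : V ∈ testGraph1 B) : tensorGraph U V ∈ testGraph2 (A ×ˢ B) := by
  obtain ⟨φ, hφ, h1, h2⟩ := hU
  obtain ⟨ψ, hψ, k1, k2⟩ := hV
  have hd : ∀ p v : ℝ × ℝ, fderiv ℝ (fun p : ℝ × ℝ => φ p.1 * ψ p.2) p v
      = deriv φ p.1 * v.1 * ψ p.2 + φ p.1 * (deriv ψ p.2 * v.2) := by
    intro p v
    have e1 : HasFDerivAt (fun p : ℝ × ℝ => φ p.1)
        ((deriv φ p.1) • ContinuousLinearMap.fst ℝ ℝ ℝ) p :=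
      (hφ.differentiable p.1).hasDerivAt.comp_hasFDerivAt p hasFDerivAt_fst
    have e2 : HasFDerivAt (fun p : ℝ × ℝ => ψ p.2)
        ((deriv ψ p.2) • ContinuousLinearMap.snd ℝ ℝ ℝ) p :=
      (hψ.differentiable p.2).hasDerivAt.comp_hasFDerivAt p hasFDerivAt_snd
    have e3 : HasFDerivAt (fun p : ℝ × ℝ => φ p.1 * ψ p.2) _ p := e1.mul e2
    rw [e3.fderiv]
    simp
    ring
  refine ⟨_, isTestFunction_tensor hφ hψ, ?_, ?_, ?_⟩
  · filter_upwards [coeFn_tensorL2 U.fst V.fst, ae_fst_prod h1, ae_snd_prod k1] with p a b c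
    exact a.trans (by rw [b, c])
  · filter_upwards [coeFn_tensorL2 U.snd V.fst, ae_fst_prod h2, ae_snd_prod k1] with p a b c
    exact a.trans (by rw [b, c, hd]; simp)
  · filter_upwards [coeFn_tensorL2 U.fst V.snd, ae_fst_prod h1, ae_snd_prod k2] with p a b c
    exact a.trans (by rw [b, c, hd]; simp)

lemma tensorGraph_mem_H10 (r : H10Line A) (s : H10Line B) :
    tensorGraph (r : WithLp 2 (L2 A × L2 A)) (s : WithLp 2 (L2 B × L2 B)) ∈ H10 (A ×ˢ B) :=
  map_mem_closure₂ continuous_tensorGraph r.2 s.2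
    (fun _ hU _ hV => tensorGraph_mem_testGraph2 hU hV)

/-- The tensor product `r ⊗ s ∈ H¹₀(A × B)` of `r ∈ H¹₀(A)` and `s ∈ H¹₀(B)`: it is the function
`(x, y) ↦ r(x) s(y)`, and its weak gradient is `(x, y) ↦ (r'(x) s(y), r(x) s'(y))`. -/
def tensor (r : H10Line A) (s : H10Line B) : H10 (A ×ˢ B) :=
  ⟨tensorGraph r s, tensorGraph_mem_H10 r s⟩

end Tensor

/-! ### The pure greedy algorithm -/

/-- The energy `½ ∫_Ω |∇u|² - ⟨F, u⟩` of `u ∈ H¹₀(Ω)` for the load `F ∈ H⁻¹(Ω)`. -/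
def energy {Ω : Set (ℝ × ℝ)} (F : Hneg Ω) (u : H10 Ω) : ℝ :=
  (1 / 2) * ‖grad Ω u‖ ^ 2 - F u

/-- The data of the algorithm: `f₀ = f` and `fₙ = fₙ₋₁ + Δ(rₙ ⊗ sₙ)` for `n ≥ 1`. The values `r 0`
and `s 0` are not used. -/
def load {A B : Set ℝ} (f : L2 (A ×ˢ B)) (r : ℕ → H10Line A) (s : ℕ → H10Line B) :
    ℕ → Hneg (A ×ˢ B)
  | 0 => ofL2 f
  | n + 1 => load f r s n + laplacian (tensor (r (n + 1)) (s (n + 1)))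

/-- The Euler–Lagrange equations of the rank-one problem with load `F`, at `(r₀, s₀)`. -/
def IsEulerLagrange {A B : Set ℝ} (F : Hneg (A ×ˢ B)) (r₀ : H10Line A) (s₀ : H10Line B) : Prop :=
  ∀ (r : H10Line A) (s : H10Line B),
    inner ℝ (grad (A ×ˢ B) (tensor r₀ s₀)) (grad (A ×ˢ B) (tensor r₀ s + tensor r s₀)) =
      F (tensor r₀ s + tensor r s₀)

/-- `(r₀, s₀)` minimizes the energy with load `F` among all rank-one functions. -/
def IsRankOneMinimizer {A B : Set ℝ} (F : Hneg (A ×ˢ B)) (r₀ : H10Line A) (s₀ : H10Line B) :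
    Prop :=
  ∀ (r : H10Line A) (s : H10Line B), energy F (tensor r₀ s₀) ≤ energy F (tensor r s)

end PureGreedy

end

open PureGreedy

namespace PureGreedy

/-! ### Greedy algorithms in a Hilbert space -/

/-! If `-Δg = f`, then `f_n = -Δg_n`, so the load acts on `v` as the Dirichlet inner product of
`g_n` with `v`. The algorithm is thus a pure greedy algorithm for that inner product, with the
products `r ⊗ s` as dictionary. Write `t_n` for `r_n ⊗ s_n` and use the Dirichlet norm. The
Euler–Lagrange equations, or minimality along the line through `t_n`, give `⟨g_{n-1}, t_n⟩ =
‖t_n‖²`. Hence `E_n = -½‖t_n‖²`, and each step removes exactly `‖t_n‖²` from the squared norm of the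
residual; telescoping bounds the series.

For minimizers, moreover, `|⟨g_{n-1}, d⟩| ≤ ‖t_n‖ ‖d‖` for every product `d`
(`abs_inner_le_of_isMinOn`). Jones' argument (`cauchySeq_of_greedy`) then makes the residuals
Cauchy, and since `‖t_n‖ → 0` their limit is orthogonal to every product. Products are total
(`inner_grad_eq_zero_of_forall_tensor`), so the limit is zero. The Poincaré inequality provides `g`
and carries convergence from the gradient norm to the `H¹` norm.

Totality rests on `exists_tensorTest_fderiv_near`: the mixed derivative of a test function is
approximated by polynomials, which are integrated in each variable and then cut off by a product of
cutoffs. -/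

lemma exists_mul_sum_lt_of_summable_sq {a : ℕ → ℝ}
    (hs : Summable fun n => a n ^ 2) {ε : ℝ} (hε : 0 < ε) (N : ℕ) :
    ∃ m ≥ N, a m * ∑ k ∈ Finset.range m, a k < ε := by
  by_contra! h
  set A := ∑' n, a n ^ 2
  -- By Cauchy–Schwarz the partial sums grow at most like `√m`. If the products stayed above `ε`,
  -- then `a m ^ 2` would dominate a multiple of `1 / m`, and the harmonic series would converge.
  have hsum : ∀ m, (∑ k ∈ Finset.range m, a k) ^ 2 ≤ m * A := fun m => by
    have h1 := sq_sum_le_card_mul_sum_sq (s := Finset.range m) (f := a)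
    rw [Finset.card_range] at h1
    exact h1.trans (mul_le_mul_of_nonneg_left
      (hs.sum_le_tsum _ fun i _ => sq_nonneg (a i)) m.cast_nonneg)
  have hlow : ∀ m ≥ N, ε ^ 2 ≤ a m ^ 2 * (m * A) := fun m hm => by
    have h1 := pow_le_pow_left₀ hε.le (h m hm) 2
    rw [mul_pow] at h1
    exact h1.trans (mul_le_mul_of_nonneg_left (hsum m) (sq_nonneg _))
  have hA : 0 < A := by
    by_contra hA
    have h1 : A ≤ 0 := not_lt.1 hA
    have h2 := hlow N le_rfl
    have h3 : a N ^ 2 * (N * A) ≤ 0 :=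
      mul_nonpos_of_nonneg_of_nonpos (sq_nonneg _)
        (mul_nonpos_of_nonneg_of_nonpos N.cast_nonneg h1)
    have := pow_pos hε 2
    linarith
  have hh : Summable fun m : ℕ => (1 / (m : ℝ)) := by
    refine Summable.of_norm_bounded_eventually_nat (hs.mul_left (A / ε ^ 2)) ?_
    filter_upwards [eventually_ge_atTop (max N 1)] with m hm
    have hm0 : (0 : ℝ) < m := by exact_mod_cast (le_max_right N 1).trans hm
    have h1 := hlow m ((le_max_left N 1).trans hm)
    rw [Real.norm_of_nonneg (by positivity), div_mul_eq_mul_div,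
      div_le_div_iff₀ hm0 (by positivity)]
    linarith
  exact Real.not_summable_one_div_natCast hh

section Hilbert

variable {H : Type*} [NormedAddCommGroup H] [InnerProductSpace ℝ H] {γ τ : ℕ → H}

/-- If `t` minimizes `½‖·‖² - ℓ` along the line it spans, then `‖t‖² = ℓ(t)`. -/
lemma norm_sq_eq_of_isMinOn {ℓ : H → ℝ} {t : H} (hℓ : ∀ c : ℝ, ℓ (c • t) = c * ℓ t)
    (hmin : ∀ c : ℝ, (1 / 2) * ‖t‖ ^ 2 - ℓ t ≤ (1 / 2) * ‖c • t‖ ^ 2 - ℓ (c • t)) :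
    ‖t‖ ^ 2 = ℓ t := by
  have h : ∀ c : ℝ, (1 / 2) * ‖t‖ ^ 2 - ℓ t ≤ (1 / 2) * (c ^ 2 * ‖t‖ ^ 2) - c * ℓ t := by
    intro c
    have := hmin c
    rwa [hℓ, norm_smul, mul_pow, Real.norm_eq_abs, sq_abs] at this
  by_cases ht : ‖t‖ ^ 2 = 0
  -- When `t` has norm zero the energy along its line is linear; the values at `2` and `0` force `ℓ
  -- t` to vanish.
  · have h1 := h 2
    have h2 := h 0
    rw [ht] at *
    linarith
  · have hpos : 0 < ‖t‖ ^ 2 := lt_of_le_of_ne (sq_nonneg _) (Ne.symm ht)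
    -- This is the vertex of the quadratic in `c`. Comparing its value with that at `c = 1` leaves a
    -- perfect square that is at most zero.
    have h1 := h (ℓ t / ‖t‖ ^ 2)
    have h2 : (1 / 2) * ((ℓ t / ‖t‖ ^ 2) ^ 2 * ‖t‖ ^ 2) - ℓ t / ‖t‖ ^ 2 * ℓ t
        = - (ℓ t ^ 2 / (2 * ‖t‖ ^ 2)) := by field_simp; ring
    rw [h2] at h1
    have h3 : (‖t‖ ^ 2 - ℓ t) ^ 2 / (2 * ‖t‖ ^ 2) ≤ 0 := by
      have : (‖t‖ ^ 2 - ℓ t) ^ 2 / (2 * ‖t‖ ^ 2)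
          = (1 / 2) * ‖t‖ ^ 2 - ℓ t + ℓ t ^ 2 / (2 * ‖t‖ ^ 2) := by
        generalize ‖t‖ ^ 2 = q at *
        field_simp; ring
      linarith
    have h4 : (‖t‖ ^ 2 - ℓ t) ^ 2 ≤ 0 := by
      by_contra h5
      have : 0 < (‖t‖ ^ 2 - ℓ t) ^ 2 / (2 * ‖t‖ ^ 2) := by
        have := not_le.1 h5
        positivity
      linarith
    have := pow_eq_zero_iff (two_ne_zero) |>.1 (le_antisymm h4 (sq_nonneg _))
    linarith

lemma norm_sub_sq_of_inner_eq {x t : H} (h : inner ℝ x t = ‖t‖ ^ 2) :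
    ‖x - t‖ ^ 2 = ‖x‖ ^ 2 - ‖t‖ ^ 2 := by
  rw [norm_sub_sq_real, h]; ring

/-- If each step removes `‖τ n‖²` from `‖γ n‖²`, the steps are square-summable. -/
lemma summable_norm_sq_of_inner_eq (hγ : ∀ n, γ (n + 1) = γ n - τ n)
    (hτ : ∀ n, inner ℝ (γ n) (τ n) = ‖τ n‖ ^ 2) : Summable fun n => ‖τ n‖ ^ 2 := by
  refine summable_of_sum_range_le (c := ‖γ 0‖ ^ 2) (fun n => sq_nonneg _) fun n => ?_
  have : ∑ i ∈ Finset.range n, ‖τ i‖ ^ 2 = ‖γ 0‖ ^ 2 - ‖γ n‖ ^ 2 := by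
    rw [← Finset.sum_range_sub' (fun i => ‖γ i‖ ^ 2)]
    refine Finset.sum_congr rfl fun i _ => ?_
    rw [hγ, norm_sub_sq_of_inner_eq (hτ i)]; ring
  rw [this]
  linarith [sq_nonneg ‖γ n‖]

/-- The correlation of the residual with a dictionary element is controlled by the greedy step. -/
lemma abs_inner_le_of_isMinOn {x t d : H} (ht : inner ℝ x t = ‖t‖ ^ 2)
    (hmin : ∀ c : ℝ, (1 / 2) * ‖t‖ ^ 2 - inner ℝ x t ≤
      (1 / 2) * ‖c • d‖ ^ 2 - inner ℝ x (c • d)) :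
    |inner ℝ x d| ≤ ‖t‖ * ‖d‖ := by
  by_cases hd : d = 0
  · simp [hd]
  have hpos : 0 < ‖d‖ ^ 2 := by positivity
  -- The best multiple of `d` lowers the energy by half the squared correlation of `x` with `d /
  -- ‖d‖`, while `t` lowers it by `½‖t‖²`.
  have h1 := hmin (inner ℝ x d / ‖d‖ ^ 2)
  rw [norm_smul, mul_pow, Real.norm_eq_abs, sq_abs, inner_smul_right, ht] at h1
  have h2 : (1 / 2) * ((inner ℝ x d / ‖d‖ ^ 2) ^ 2 * ‖d‖ ^ 2)
      - inner ℝ x d / ‖d‖ ^ 2 * inner ℝ x d = - ((1 / 2) * (inner ℝ x d ^ 2 / ‖d‖ ^ 2)) := by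
    field_simp; ring
  rw [h2] at h1
  have h3 : inner ℝ x d ^ 2 / ‖d‖ ^ 2 ≤ ‖t‖ ^ 2 := by linarith
  rw [div_le_iff₀ hpos, ← mul_pow] at h3
  exact abs_le_of_sq_le_sq h3 (by positivity)

/-- **Jones' theorem**: the residuals of a pure greedy algorithm form a Cauchy sequence. -/
theorem cauchySeq_of_greedy (hγ : ∀ n, γ (n + 1) = γ n - τ n)
    (hτ : ∀ n, inner ℝ (γ n) (τ n) = ‖τ n‖ ^ 2)
    (hgreedy : ∀ n k, |inner ℝ (γ n) (τ k)| ≤ ‖τ n‖ * ‖τ k‖) : CauchySeq γ := by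
  have hsum := summable_norm_sq_of_inner_eq hγ hτ
  have hanti : Antitone fun n => ‖γ n‖ ^ 2 := antitone_nat_of_succ_le fun n => by
    rw [hγ, norm_sub_sq_of_inner_eq (hτ n)]
    linarith [sq_nonneg ‖τ n‖]
  have hbdd : BddBelow (Set.range fun n => ‖γ n‖ ^ 2) :=
    ⟨0, by rintro _ ⟨n, rfl⟩; exact sq_nonneg _⟩
  have hlim := tendsto_atTop_ciInf hanti hbdd
  set L := ⨅ n, ‖γ n‖ ^ 2
  have hL : ∀ n, L ≤ ‖γ n‖ ^ 2 := fun n => ciInf_le hbdd n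
  -- The difference is a sum of earlier steps, each controlled by the greedy inequality at time `m`.
  -- Enlarging the sum to all `k < m` makes the bound independent of `n`.
  have hdiff : ∀ n m, n ≤ m → |inner ℝ (γ m) (γ n - γ m)| ≤
      ‖τ m‖ * ∑ k ∈ Finset.range m, ‖τ k‖ := by
    intro n m hnm
    have h1 : γ n - γ m = ∑ k ∈ Finset.Ico n m, τ k := by
      have h := Finset.sum_Ico_sub γ hnm
      rw [← neg_sub, ← h, ← Finset.sum_neg_distrib]
      exact Finset.sum_congr rfl fun k _ => by rw [hγ]; abel
    rw [h1, inner_sum, Finset.mul_sum]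
    refine (Finset.abs_sum_le_sum_abs _ _).trans ?_
    refine (Finset.sum_le_sum fun k _ => hgreedy m k).trans ?_
    refine Finset.sum_le_sum_of_subset_of_nonneg (fun k hk => ?_) fun k _ _ => by positivity
    exact Finset.mem_range.2 (Finset.mem_Ico.1 hk).2
  rw [Metric.cauchySeq_iff']
  intro ε hε
  obtain ⟨N, hN⟩ := ((tendsto_order.1 hlim).2 (L + ε ^ 2 / 16)
    (by have := pow_pos hε 2; linarith)).exists
  refine ⟨N, fun n hn => ?_⟩
  -- The cross term is small only for special indices `m`, but these occur beyond any `n`. One such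
  -- `m` serves as intermediate point between `γ n` and `γ N`.
  obtain ⟨m, hm, hmlt⟩ := exists_mul_sum_lt_of_summable_sq hsum
    (show 0 < ε ^ 2 / 16 by positivity) n
  have key : ∀ k, N ≤ k → k ≤ m → ‖γ k - γ m‖ < ε / 2 := by
    intro k hNk hkm
    have h1 : ‖γ k - γ m‖ ^ 2 = ‖γ k‖ ^ 2 - ‖γ m‖ ^ 2 - 2 * inner ℝ (γ m) (γ k - γ m) := by
      have : ‖γ k‖ ^ 2 = ‖γ m + (γ k - γ m)‖ ^ 2 := by rw [add_sub_cancel]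
      rw [this, norm_add_sq_real]; ring
    have h2 := (abs_le.1 (hdiff k m hkm)).1
    have h3 : ‖γ k‖ ^ 2 ≤ ‖γ N‖ ^ 2 := hanti hNk
    have h4 := hL m
    refine lt_of_pow_lt_pow_left₀ 2 (by positivity) ?_
    rw [h1]
    -- The decrease of the squared norm contributes less than `ε² / 16` and the cross term less than
    -- `ε² / 8`; their sum is below `(ε / 2)²`.
    nlinarith
  calc dist (γ n) (γ N) ≤ dist (γ n) (γ m) + dist (γ N) (γ m) := dist_triangle_right _ _ _
    _ < ε / 2 + ε / 2 := by
      rw [dist_eq_norm, dist_eq_norm]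
      exact add_lt_add (key n hn hm) (key N le_rfl (hn.trans hm))
    _ = ε := add_halves ε

/-- The limit of the residuals of a greedy algorithm is orthogonal to the dictionary. -/
lemma inner_eq_zero_of_tendsto_of_greedy (hsum : Summable fun n => ‖τ n‖ ^ 2) {x d : H}
    (hx : Tendsto γ atTop (𝓝 x)) (hd : ∀ n, |inner ℝ (γ n) d| ≤ ‖τ n‖ * ‖d‖) :
    inner ℝ x d = 0 := by
  have h0 : Tendsto (fun n => ‖τ n‖) atTop (𝓝 0) := by
    have := hsum.tendsto_atTop_zero.sqrt
    simpa [Real.sqrt_sq] using this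
  have h1 : Tendsto (fun n => inner ℝ (γ n) d) atTop (𝓝 0) :=
    squeeze_zero_norm hd (by simpa using h0.mul_const ‖d‖)
  exact tendsto_nhds_unique (hx.inner tendsto_const_nhds) h1

end Hilbert

/-! ### The Poincaré inequality and the Dirichlet problem -/

/-- A form `⟨G u, G v⟩` with `G` bounded below represents every continuous linear functional. -/
lemma exists_inner_apply_eq_of_norm_le {V W : Type*} [NormedAddCommGroup V]
    [InnerProductSpace ℝ V] [CompleteSpace V] [NormedAddCommGroup W] [InnerProductSpace ℝ W]
    (G : V →L[ℝ] W) {C : ℝ} (hC : 0 < C) (hG : ∀ u, ‖u‖ ≤ C * ‖G u‖) (F : StrongDual ℝ V) :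
    ∃ g : V, ∀ v, inner ℝ (G g) (G v) = F v := by
  let B : V →L[ℝ] V →L[ℝ] ℝ := (ContinuousLinearMap.precomp ℝ G).comp ((innerSL ℝ).comp G)
  have hB : ∀ u v, B u v = inner ℝ (G u) (G v) := fun u v => rfl
  -- Coercivity is the squared lower bound on `G`; Lax–Milgram combined with the Riesz
  -- representation of `F` then gives the solution.
  have hcoer : IsCoercive B := by
    refine ⟨(C ^ 2)⁻¹, by positivity, fun u => ?_⟩
    rw [hB, real_inner_self_eq_norm_sq, mul_assoc, inv_mul_le_iff₀ (by positivity), ← mul_pow,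
      ← sq]
    exact pow_le_pow_left₀ (norm_nonneg _) (hG u) 2
  refine ⟨hcoer.continuousLinearEquivOfBilin.symm ((InnerProductSpace.toDual ℝ V).symm F),
    fun v => ?_⟩
  have h := hcoer.continuousLinearEquivOfBilin_apply
    (hcoer.continuousLinearEquivOfBilin.symm ((InnerProductSpace.toDual ℝ V).symm F)) v
  rw [ContinuousLinearEquiv.apply_symm_apply, InnerProductSpace.toDual_symm_apply, hB] at h
  exact h.symm

section Poincare

variable {Ω : Set (ℝ × ℝ)}

lemma IsTestFunction.continuous_fderiv_apply {φ : ℝ × ℝ → ℝ} (hφ : IsTestFunction Ω φ)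
    (v : ℝ × ℝ) : Continuous fun p => fderiv ℝ φ p v :=
  (hφ.1.continuous_fderiv (by simp)).clm_apply continuous_const

/-- The **Poincaré inequality** for test functions, by integration by parts against `x`. -/
lemma IsTestFunction.integral_sq_le {φ : ℝ × ℝ → ℝ} (hφ : IsTestFunction Ω φ) {R : ℝ}
    (hR : ∀ p ∈ Ω, |p.1| ≤ R) :
    ∫ p, φ p ^ 2 ≤ 4 * R ^ 2 * ∫ p, fderiv ℝ φ p (1, 0) ^ 2 := by
  have hc := hφ.1.continuous
  obtain ⟨d, hdφ⟩ : ∃ d : ℝ × ℝ → ℝ, ∀ p, fderiv ℝ φ p (1, 0) = d p := ⟨_, fun _ => rfl⟩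
  have hd : Continuous d := (hφ.continuous_fderiv_apply (1, 0)).congr hdφ
  have hs : HasCompactSupport φ := hφ.2.1
  have hs' : HasCompactSupport d := by
    simpa only [hdφ] using hs.fderiv_apply ℝ (1, 0)
  simp only [hdφ]
  have hsq : ∀ p, HasFDerivAt (fun p => φ p ^ 2) ((2 * φ p) • fderiv ℝ φ p) p := fun p => by
    simpa using (hφ.differentiable p).hasFDerivAt.pow 2
  have hsqc : HasCompactSupport fun p => φ p ^ 2 := hs.comp_left (g := fun t => t ^ 2) (by simp)
  have hsqc' : HasCompactSupport fun p => d p ^ 2 :=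
    hs'.comp_left (g := fun t => t ^ 2) (by simp)
  have hcsq : Continuous fun p => φ p ^ 2 := hc.pow 2
  have hdsq : Continuous fun p => d p ^ 2 := hd.pow 2
  have hint : Integrable fun p => φ p ^ 2 := hcsq.integrable_of_hasCompactSupport hsqc
  have hint' : Integrable fun p => d p ^ 2 :=
    hdsq.integrable_of_hasCompactSupport hsqc'
  have hx : ∀ p : ℝ × ℝ, fderiv ℝ (fun q : ℝ × ℝ => q.1) p (1, 0) = 1 := fun p => by
    rw [(hasFDerivAt_fst (𝕜 := ℝ) (p := p)).fderiv]; simp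
  have hi2 : Integrable fun p : ℝ × ℝ => (2 * φ p * d p) * p.1 :=
    Continuous.integrable_of_hasCompactSupport (by fun_prop)
      (HasCompactSupport.mul_right (HasCompactSupport.mul_right (HasCompactSupport.mul_left hs)))
  have hi3 : Integrable fun p : ℝ × ℝ => φ p ^ 2 * p.1 :=
    Continuous.integrable_of_hasCompactSupport (by fun_prop) (HasCompactSupport.mul_right hsqc)
  -- Since `∂ₓ x = 1`, this reads `∫ φ² = -∫ 2 x φ ∂ₓφ`.
  have hibp := integral_mul_fderiv_eq_neg_fderiv_mul_of_integrable (μ := volume)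
    (f := fun p => φ p ^ 2) (g := fun p : ℝ × ℝ => p.1) (v := (1, 0))
    (by simpa [(hsq _).fderiv, hdφ] using hi2) (by simpa only [hx, mul_one] using hint)
    hi3
    (fun p _ => (hsq p).differentiableAt) (fun p _ => differentiableAt_fst)
  simp only [hx, mul_one, (hsq _).fderiv, smul_apply, smul_eq_mul, hdφ] at hibp
  -- Young's inequality, weighted so that only half of `∫ φ²` appears on the right and can be
  -- absorbed. The bound on `x` is available only where `φ` is nonzero, which suffices.
  have hle : -∫ p : ℝ × ℝ, (2 * φ p * d p) * p.1 ≤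
      ∫ p : ℝ × ℝ, ((1 / 2) * φ p ^ 2 + 2 * R ^ 2 * d p ^ 2) := by
    rw [← integral_neg]
    have hi4 : Integrable fun p : ℝ × ℝ => -((2 * φ p * d p) * p.1) := hi2.neg
    have hi5 : Integrable fun p => (1 / 2) * φ p ^ 2 + 2 * R ^ 2 * d p ^ 2 :=
      (hint.const_mul _).add (hint'.const_mul _)
    refine integral_mono hi4 hi5 fun p => ?_
    by_cases hp : φ p = 0
    · simp only [hp]
      have : 0 ≤ 2 * R ^ 2 * d p ^ 2 := by positivity
      simpa using this
    · have hp' : p.1 ^ 2 ≤ R ^ 2 := by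
        rw [← sq_abs]
        exact pow_le_pow_left₀ (abs_nonneg _) (hR p (hφ.2.2 (subset_tsupport φ hp))) 2
      have := mul_le_mul_of_nonneg_right hp' (sq_nonneg (d p))
      dsimp only
      nlinarith [sq_nonneg (φ p + 2 * (p.1 * d p))]
  rw [integral_add (hint.const_mul _) (hint'.const_mul _), integral_const_mul,
    integral_const_mul] at hle
  linarith

/-- The inequality is a closed condition, so it passes from test functions to their closure. For
test functions, integrals over `Ω` and over the plane agree because the support lies in `Ω`. -/
lemma norm_val_le {R : ℝ} (hR0 : 0 ≤ R) (hR : ∀ p ∈ Ω, |p.1| ≤ R) (u : H10 Ω) :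
    ‖val Ω u‖ ≤ 2 * R * ‖grad Ω u‖ := by
  let W := WithLp 2 (L2 Ω × WithLp 2 (L2 Ω × L2 Ω))
  let f := WithLp.fstL 2 ℝ (L2 Ω) (WithLp 2 (L2 Ω × L2 Ω))
  let g := WithLp.sndL 2 ℝ (L2 Ω) (WithLp 2 (L2 Ω × L2 Ω))
  have hcl : IsClosed {U : W | ‖f U‖ ≤ 2 * R * ‖g U‖} :=
    isClosed_le f.continuous.norm (continuous_const.mul g.continuous.norm)
  have hmem : (u : W) ∈ closure (testGraph2 Ω : Set W) := u.2
  refine closure_minimal (fun U hU => ?_) hcl hmem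
  obtain ⟨φ, hφ, h1, h2, -⟩ := hU
  have e1 : ‖U.fst‖ ^ 2 = ∫ p, φ p ^ 2 := by
    rw [norm_sq_L2, integral_congr_ae (h1.mono fun p hp => congrArg (· ^ 2) hp)]
    refine setIntegral_eq_integral_of_forall_compl_eq_zero fun p hp => ?_
    rw [image_eq_zero_of_notMem_tsupport fun h => hp (hφ.2.2 h)]; simp
  have e2 : ‖U.snd.fst‖ ^ 2 = ∫ p, fderiv ℝ φ p (1, 0) ^ 2 := by
    rw [norm_sq_L2, integral_congr_ae (h2.mono fun p hp => congrArg (· ^ 2) hp)]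
    refine setIntegral_eq_integral_of_forall_compl_eq_zero fun p hp => ?_
    have : fderiv ℝ φ p = 0 := image_eq_zero_of_notMem_tsupport fun h =>
      hp (hφ.2.2 (tsupport_fderiv_subset ℝ h))
    rw [this]; simp
  have h3 : ‖U.fst‖ ≤ 2 * R * ‖U.snd.fst‖ := by
    refine le_of_sq_le_sq ?_ (by positivity)
    rw [mul_pow, e1, e2]
    exact (hφ.integral_sq_le hR).trans (le_of_eq (by ring))
  have h4 : ‖U.snd.fst‖ ≤ ‖U.snd‖ := by
    refine le_of_sq_le_sq ?_ (norm_nonneg _)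
    rw [WithLp.prod_norm_sq_eq_of_L2]
    linarith [sq_nonneg ‖U.snd.snd‖]
  exact h3.trans (mul_le_mul_of_nonneg_left h4 (by positivity))

lemma norm_sq_eq_val_add_grad (u : H10 Ω) : ‖u‖ ^ 2 = ‖val Ω u‖ ^ 2 + ‖grad Ω u‖ ^ 2 :=
  WithLp.prod_norm_sq_eq_of_L2 (u : WithLp 2 (L2 Ω × WithLp 2 (L2 Ω × L2 Ω)))

/-- On a bounded domain, the `H¹` norm is controlled by the norm of the gradient. -/
lemma exists_norm_le_mul_norm_grad (hΩ : Bornology.IsBounded Ω) :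
    ∃ C : ℝ, 0 < C ∧ ∀ u : H10 Ω, ‖u‖ ≤ C * ‖grad Ω u‖ := by
  obtain ⟨R, hR⟩ := hΩ.exists_norm_le
  have hR' : ∀ p ∈ Ω, |p.1| ≤ max R 0 := fun p hp =>
    (norm_fst_le p).trans ((hR p hp).trans (le_max_left _ _))
  -- The square of this constant dominates `(2 * max R 0) ^ 2 + 1`, the sum of the contributions of
  -- `u` and `∇u`.
  refine ⟨2 * max R 0 + 1, by positivity, fun u => le_of_sq_le_sq ?_ (by positivity)⟩
  have h1 := pow_le_pow_left₀ (norm_nonneg _) (norm_val_le (le_max_right R 0) hR' u) 2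
  have h2 : 0 ≤ max R 0 * ‖grad Ω u‖ ^ 2 := by positivity
  rw [norm_sq_eq_val_add_grad]
  nlinarith

instance : CompleteSpace (H10 Ω) :=
  (Submodule.isClosed_topologicalClosure (testGraph2 Ω)).completeSpace_coe

lemma laplacian_apply (u v : H10 Ω) : laplacian u v = -inner ℝ (grad Ω u) (grad Ω v) := rfl

lemma laplacian_sub (u v : H10 Ω) : laplacian (u - v) = laplacian u - laplacian v := by
  ext w
  simp only [sub_apply, laplacian_apply, map_sub, inner_sub_left]
  ring

lemma continuous_laplacian : Continuous (laplacian : H10 Ω → Hneg Ω) :=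
  ((ContinuousLinearMap.precomp ℝ (grad Ω)).continuous.comp
    ((innerSL ℝ).continuous.comp (grad Ω).continuous)).neg

set_option maxHeartbeats 1000000 in
/-- The Dirichlet problem `-Δg = F` has a weak solution, for every `F ∈ H⁻¹(Ω)`. -/
lemma exists_neg_laplacian_eq (hΩ : Bornology.IsBounded Ω) (F : Hneg Ω) :
    ∃ g : H10 Ω, -laplacian g = F := by
  obtain ⟨C, hC, hle⟩ := exists_norm_le_mul_norm_grad hΩ
  obtain ⟨g, hg⟩ := exists_inner_apply_eq_of_norm_le (V := H10 Ω) (grad Ω) hC hle F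
  exact ⟨g, ContinuousLinearMap.ext fun v => (neg_neg _).trans (hg v)⟩

end Poincare

/-! ### Approximation by sums of products -/

/-- `ux`, `uy` are the partial derivatives of `u`, and `uxy` is the mixed second derivative. -/
structure HasMixedDeriv (u ux uy uxy : ℝ → ℝ → ℝ) : Prop where
  dx : ∀ x y, HasDerivAt (fun t => u t y) (ux x y) x
  dy : ∀ x y, HasDerivAt (fun t => u x t) (uy x y) y
  dyx : ∀ x y, HasDerivAt (fun t => uy t y) (uxy x y) x
  dxy : ∀ x y, HasDerivAt (fun t => ux x t) (uxy x y) y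

section MixedDeriv

variable {u ux uy uxy v vx vy vxy : ℝ → ℝ → ℝ}

lemma HasMixedDeriv.add (hu : HasMixedDeriv u ux uy uxy) (hv : HasMixedDeriv v vx vy vxy) :
    HasMixedDeriv (u + v) (ux + vx) (uy + vy) (uxy + vxy) :=
  ⟨fun x y => (hu.dx x y).add (hv.dx x y), fun x y => (hu.dy x y).add (hv.dy x y),
    fun x y => (hu.dyx x y).add (hv.dyx x y), fun x y => (hu.dxy x y).add (hv.dxy x y)⟩

lemma HasMixedDeriv.sub (hu : HasMixedDeriv u ux uy uxy) (hv : HasMixedDeriv v vx vy vxy) :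
    HasMixedDeriv (u - v) (ux - vx) (uy - vy) (uxy - vxy) :=
  ⟨fun x y => (hu.dx x y).sub (hv.dx x y), fun x y => (hu.dy x y).sub (hv.dy x y),
    fun x y => (hu.dyx x y).sub (hv.dyx x y), fun x y => (hu.dxy x y).sub (hv.dxy x y)⟩

lemma HasMixedDeriv.smul (c : ℝ) (hu : HasMixedDeriv u ux uy uxy) :
    HasMixedDeriv (c • u) (c • ux) (c • uy) (c • uxy) :=
  ⟨fun x y => (hu.dx x y).const_smul c, fun x y => (hu.dy x y).const_smul c,
    fun x y => (hu.dyx x y).const_smul c, fun x y => (hu.dxy x y).const_smul c⟩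

lemma HasMixedDeriv.mul {P P' Q Q' : ℝ → ℝ} (hP : ∀ x, HasDerivAt P (P' x) x)
    (hQ : ∀ y, HasDerivAt Q (Q' y) y) :
    HasMixedDeriv (fun x y => P x * Q y) (fun x y => P' x * Q y) (fun x y => P x * Q' y)
      (fun x y => P' x * Q' y) :=
  ⟨fun x _ => (hP x).mul_const _, fun _ y => (hQ y).const_mul _,
    fun x _ => (hP x).mul_const _, fun _ y => (hQ y).const_mul _⟩

lemma hasDerivAt_fst_of_differentiable {f : ℝ × ℝ → ℝ} (hf : Differentiable ℝ f) (x y : ℝ) :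
    HasDerivAt (fun t => f (t, y)) (fderiv ℝ f (x, y) (1, 0)) x :=
  (hf (x, y)).hasFDerivAt.comp_hasDerivAt x ((hasDerivAt_id x).prodMk (hasDerivAt_const x y))

lemma hasDerivAt_snd_of_differentiable {f : ℝ × ℝ → ℝ} (hf : Differentiable ℝ f) (x y : ℝ) :
    HasDerivAt (fun t => f (x, t)) (fderiv ℝ f (x, y) (0, 1)) y :=
  (hf (x, y)).hasFDerivAt.comp_hasDerivAt y ((hasDerivAt_const y x).prodMk (hasDerivAt_id y))

/-- Symmetry of the second derivative makes one function serve both orders of differentiation; it is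
bundled as continuous for use in Stone–Weierstrass. -/
lemma exists_hasMixedDeriv_of_contDiff {φ : ℝ × ℝ → ℝ} (hφ : ContDiff ℝ ∞ φ) :
    ∃ φxy : C(ℝ × ℝ, ℝ), HasMixedDeriv (fun x y => φ (x, y))
      (fun x y => fderiv ℝ φ (x, y) (1, 0)) (fun x y => fderiv ℝ φ (x, y) (0, 1))
      (fun x y => φxy (x, y)) := by
  have hd : ContDiff ℝ ∞ (fderiv ℝ φ) := hφ.fderiv_right (by simp)
  have hdd : Differentiable ℝ (fderiv ℝ φ) := hd.differentiable (by simp)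
  have hφd : Differentiable ℝ φ := hφ.differentiable (by simp)
  have happ : ∀ (v : ℝ × ℝ) (p : ℝ × ℝ) (w : ℝ × ℝ),
      fderiv ℝ (fun q => fderiv ℝ φ q v) p w = fderiv ℝ (fderiv ℝ φ) p w v := fun v p w => by
    rw [fderiv_clm_apply (hdd p) (differentiableAt_const v)]; simp
  have hcont : Continuous fun p => fderiv ℝ (fderiv ℝ φ) p (1, 0) (0, 1) :=
    ((hd.continuous_fderiv (by simp)).clm_apply continuous_const).clm_apply continuous_const
  have hdv : ∀ v, Differentiable ℝ fun q => fderiv ℝ φ q v := fun v =>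
    hdd.clm_apply (differentiable_const v)
  refine ⟨⟨_, hcont⟩, fun x y => hasDerivAt_fst_of_differentiable hφd x y,
    fun x y => hasDerivAt_snd_of_differentiable hφd x y, fun x y => ?_, fun x y => ?_⟩
  · have h := hasDerivAt_fst_of_differentiable (hdv (0, 1)) x y
    rwa [happ] at h
  · have h := hasDerivAt_snd_of_differentiable (hdv (1, 0)) x y
    have hsymm : IsSymmSndFDerivAt ℝ φ (x, y) := hφ.contDiffAt.isSymmSndFDerivAt
      (by simpa using WithTop.coe_le_coe.2 (le_top : (2 : ℕ∞) ≤ ⊤))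
    rwa [happ, hsymm.eq] at h

lemma abs_le_of_hasDerivAt {f f' : ℝ → ℝ} {R C : ℝ} (hf : ∀ x, HasDerivAt f (f' x) x)
    (h0 : f (-R) = 0) (hC0 : 0 ≤ C) (hC : ∀ x ∈ Icc (-R) R, |f' x| ≤ C) :
    ∀ x ∈ Icc (-R) R, |f x| ≤ C * (2 * R) := by
  intro x hx
  have h := norm_image_sub_le_of_norm_deriv_le_segment' (f := f) (f' := f') (C := C)
    (fun t _ => (hf t).hasDerivWithinAt) (fun t ht => hC t ⟨ht.1, ht.2.le⟩) x hx
  rw [h0, sub_zero, Real.norm_eq_abs] at h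
  exact h.trans (mul_le_mul_of_nonneg_left (by linarith [hx.2]) hC0)

/-- A function which vanishes on two sides of a square is controlled, together with its first
derivatives, by its mixed second derivative. -/
lemma HasMixedDeriv.abs_le (hu : HasMixedDeriv u ux uy uxy) {R δ : ℝ} (hR : 0 ≤ R) (hδ : 0 ≤ δ)
    (hx0 : ∀ y, u (-R) y = 0) (hy0 : ∀ x, u x (-R) = 0)
    (h : ∀ x ∈ Icc (-R) R, ∀ y ∈ Icc (-R) R, |uxy x y| ≤ δ) :
    ∀ x ∈ Icc (-R) R, ∀ y ∈ Icc (-R) R, |u x y| ≤ δ * (2 * R) * (2 * R) ∧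
      |ux x y| ≤ δ * (2 * R) ∧ |uy x y| ≤ δ * (2 * R) := by
  -- Vanishing along a side kills the tangential derivative there, so `ux` and `uy` can each be
  -- integrated from a side where they are zero.
  have hux : ∀ x, ux x (-R) = 0 := fun x => by
    have h1 := hu.dx x (-R)
    simp only [hy0] at h1
    exact h1.unique (hasDerivAt_const x 0)
  have huy : ∀ y, uy (-R) y = 0 := fun y => by
    have h1 := hu.dy (-R) y
    simp only [hx0] at h1
    exact h1.unique (hasDerivAt_const y 0)
  have h1 : ∀ x ∈ Icc (-R) R, ∀ y ∈ Icc (-R) R, |ux x y| ≤ δ * (2 * R) := fun x hx =>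
    abs_le_of_hasDerivAt (fun y => hu.dxy x y) (hux x) hδ (h x hx)
  have h2 : ∀ y ∈ Icc (-R) R, ∀ x ∈ Icc (-R) R, |uy x y| ≤ δ * (2 * R) := fun y hy =>
    abs_le_of_hasDerivAt (fun x => hu.dyx x y) (huy y) hδ fun x hx => h x hx y hy
  intro x hx y hy
  exact ⟨abs_le_of_hasDerivAt (fun x => hu.dx x y) (hx0 y) (by positivity)
    (fun x hx => h1 x hx y hy) x hx, h1 x hx y hy, h2 y hy x hx⟩

end MixedDeriv

/-- Sums of products `a(x) b(y)` of test functions of one variable. -/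
def tensorTest (A B : Set ℝ) : Submodule ℝ (ℝ → ℝ → ℝ) :=
  Submodule.span ℝ {u | ∃ a b : ℝ → ℝ, IsTestFunction A a ∧ IsTestFunction B b ∧
    u = fun x y => a x * b y}

lemma IsTestFunction.mul_contDiff {A : Set ℝ} {a P : ℝ → ℝ} (ha : IsTestFunction A a)
    (hP : ContDiff ℝ ∞ P) : IsTestFunction A fun x => a x * P x :=
  ⟨ha.1.mul hP, ha.2.1.mul_right, (tsupport_mul_subset_left).trans ha.2.2⟩

/-- A bivariate polynomial `q` is the mixed derivative of a polynomial vanishing on two sides of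
the square of half-width `R`. -/
lemma exists_hasMixedDeriv_of_mem_adjoin (R : ℝ) {A B : Set ℝ} {χ η : ℝ → ℝ}
    (hχ : IsTestFunction A χ) (hη : IsTestFunction B η) {q : C(ℝ × ℝ, ℝ)}
    (hq : q ∈ Algebra.adjoin ℝ {(⟨Prod.fst, continuous_fst⟩ : C(ℝ × ℝ, ℝ)),
      ⟨Prod.snd, continuous_snd⟩}) :
    ∃ p px py : ℝ → ℝ → ℝ, HasMixedDeriv p px py (fun x y => q (x, y)) ∧
      (∀ y, p (-R) y = 0) ∧ (∀ x, p x (-R) = 0) ∧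
      (fun x y => χ x * η y * p x y) ∈ tensorTest A B := by
  rw [← Subalgebra.mem_toSubmodule, Algebra.adjoin_eq_span] at hq
  induction hq using Submodule.span_induction with
  | mem q hq =>
    obtain ⟨m, n, rfl⟩ := (Submonoid.mem_closure_pair _ _ _).1 hq
    -- The primitive of `x ^ k` that vanishes at `-R`; a product of two of these settles the case of
    -- a monomial.
    let P : ℕ → ℝ → ℝ := fun k x => (x ^ (k + 1) - (-R) ^ (k + 1)) / (k + 1)
    have hP : ∀ k x, HasDerivAt (P k) (x ^ k) x := fun k x => by
      have h := ((hasDerivAt_pow (k + 1) x).sub_const ((-R) ^ (k + 1))).div_const ((k : ℝ) + 1)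
      refine h.congr_deriv ?_
      have : (k : ℝ) + 1 ≠ 0 := by positivity
      push_cast
      field_simp
    have hPc : ∀ k, ContDiff ℝ ∞ (P k) := fun k =>
      ((contDiff_id.pow (k + 1)).sub contDiff_const).div_const _
    refine ⟨_, _, _, HasMixedDeriv.mul (hP m) (hP n), fun y => by simp [P], fun x => by simp [P],
      Submodule.subset_span ⟨_, _, hχ.mul_contDiff (hPc m), hη.mul_contDiff (hPc n), ?_⟩⟩
    ext x y
    ring
  | zero =>
    refine ⟨0, 0, 0, ?_, fun _ => rfl, fun _ => rfl, ?_⟩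
    · exact ⟨fun x _ => hasDerivAt_const x 0, fun _ y => hasDerivAt_const y 0,
        fun x _ => hasDerivAt_const x 0, fun _ y => hasDerivAt_const y 0⟩
    · convert (tensorTest A B).zero_mem using 1
      ext x y; simp
  | add q₁ q₂ _ _ h₁ h₂ =>
    obtain ⟨p, px, py, hp, hx, hy, ht⟩ := h₁
    obtain ⟨p', px', py', hp', hx', hy', ht'⟩ := h₂
    refine ⟨_, _, _, hp.add hp', fun y => by simp [hx, hx'], fun x => by simp [hy, hy'], ?_⟩
    convert (tensorTest A B).add_mem ht ht' using 1
    ext x y; simp [mul_add]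
  | smul c q _ h =>
    obtain ⟨p, px, py, hp, hx, hy, ht⟩ := h
    refine ⟨_, _, _, hp.smul c, fun y => by simp [hx], fun x => by simp [hy], ?_⟩
    convert (tensorTest A B).smul_mem c ht using 1
    ext x y
    simp only [Pi.smul_apply, smul_eq_mul]
    ring

/-- A smooth cutoff function. -/
lemma exists_isTestFunction_eq_one {A K : Set ℝ} (hA : IsOpen A) (hK : IsCompact K) (hKA : K ⊆ A) :
    ∃ χ : ℝ → ℝ, IsTestFunction A χ ∧ ∀ x ∈ K, χ x = 1 := by
  obtain ⟨L, hL, hKL, hLA⟩ := exists_compact_between hK hA hKA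
  obtain ⟨χ, h1, h0, -⟩ := exists_contMDiffMap_one_nhds_of_subset_interior (n := (⊤ : ℕ∞))
    (modelWithCornersSelf ℝ ℝ) hK.isClosed hKL
  have hs : tsupport χ ⊆ L := closure_minimal
    (fun x hx => by_contra fun h => hx (h0 x h)) hL.isClosed
  exact ⟨χ, ⟨χ.contMDiff.contDiff, hL.of_isClosed_subset (isClosed_tsupport _) hs, hs.trans hLA⟩,
    fun x hx => h1.self_of_nhdsSet x hx⟩

lemma IsTestFunction.exists_bound {A : Set ℝ} {χ : ℝ → ℝ} (hχ : IsTestFunction A χ) :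
    ∃ M R : ℝ, 0 ≤ M ∧ 0 < R ∧ (∀ x, |χ x| ≤ M) ∧ (∀ x, |deriv χ x| ≤ M) ∧
      ∀ x, R ≤ |x| → χ x = 0 ∧ deriv χ x = 0 := by
  obtain ⟨M₁, h₁⟩ := hχ.2.1.exists_bound_of_continuous hχ.1.continuous
  obtain ⟨M₂, h₂⟩ := hχ.2.1.deriv.exists_bound_of_continuous (hχ.1.continuous_deriv (by simp))
  obtain ⟨R, hR⟩ := hχ.2.1.isCompact.isBounded.exists_norm_le
  have hnot : ∀ x, max R 0 + 1 ≤ |x| → x ∉ tsupport χ := fun x hx h => by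
    have := (hR x h).trans (le_max_left R 0)
    rw [Real.norm_eq_abs] at this
    linarith
  -- The added `1` places the points with `|x|` equal to the radius strictly outside the support.
  refine ⟨max M₁ M₂, max R 0 + 1, (norm_nonneg _).trans ((h₁ 0).trans (le_max_left _ _)),
    by positivity, fun x => (h₁ x).trans (le_max_left _ _),
    fun x => (h₂ x).trans (le_max_right _ _), fun x hx => ⟨?_, ?_⟩⟩
  · exact image_eq_zero_of_notMem_tsupport (hnot x hx)
  · exact image_eq_zero_of_notMem_tsupport fun h => hnot x hx (tsupport_deriv_subset h)

/-! ### Totality of products in `H¹₀` -/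

section Density

variable {A B : Set ℝ}

lemma IsTestFunction.sub {E : Type*} [NormedAddCommGroup E] [NormedSpace ℝ E] {S : Set E}
    {φ ψ : E → ℝ} (hφ : IsTestFunction S φ) (hψ : IsTestFunction S ψ) :
    IsTestFunction S (φ - ψ) := by
  have h := hφ.add (hψ.smul (-1))
  rwa [neg_one_smul, ← sub_eq_add_neg] at h

lemma isTestFunction_of_mem_tensorTest {u : ℝ → ℝ → ℝ} (hu : u ∈ tensorTest A B) :
    IsTestFunction (A ×ˢ B) fun p => u p.1 p.2 := by
  induction hu using Submodule.span_induction with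
  | mem u hu =>
    obtain ⟨a, b, ha, hb, rfl⟩ := hu
    exact isTestFunction_tensor ha hb
  | zero => exact IsTestFunction.zero
  | add _ _ _ _ h₁ h₂ => exact h₁.add h₂
  | smul c _ _ h => exact h.smul c

/-- The gradient of a test function on a product is a uniform limit of gradients of sums of
products of test functions. -/
lemma exists_tensorTest_fderiv_near (hA : IsOpen A) (hB : IsOpen B) {φ : ℝ × ℝ → ℝ}
    (hφ : IsTestFunction (A ×ˢ B) φ) {ε : ℝ} (hε : 0 < ε) :
    ∃ ξ ∈ tensorTest A B, ∀ p,
      |fderiv ℝ φ p (1, 0) - fderiv ℝ (fun q => ξ q.1 q.2) p (1, 0)| ≤ ε ∧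
      |fderiv ℝ φ p (0, 1) - fderiv ℝ (fun q => ξ q.1 q.2) p (0, 1)| ≤ ε := by
  have hK : IsCompact (tsupport φ) := hφ.2.1
  obtain ⟨χ, hχ, hχ1⟩ := exists_isTestFunction_eq_one hA (hK.image continuous_fst)
    (by rintro _ ⟨p, hp, rfl⟩; exact (hφ.2.2 hp).1)
  obtain ⟨η, hη, hη1⟩ := exists_isTestFunction_eq_one hB (hK.image continuous_snd)
    (by rintro _ ⟨p, hp, rfl⟩; exact (hφ.2.2 hp).2)
  -- The cutoffs do not change `φ`, so the error of the approximant `χ η p` is `χ η (φ - p)`.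
  have hφcut : ∀ x y, φ (x, y) = χ x * η y * φ (x, y) := fun x y => by
    by_cases h : (x, y) ∈ tsupport φ
    · rw [hχ1 x ⟨_, h, rfl⟩, hη1 y ⟨_, h, rfl⟩]; ring
    · rw [image_eq_zero_of_notMem_tsupport h]; ring
  obtain ⟨M₁, R₁, hM₁, hR₁, hχb, hχb', hχ0⟩ := hχ.exists_bound
  obtain ⟨M₂, R₂, hM₂, hR₂, hηb, hηb', hη0⟩ := hη.exists_bound
  set R := max R₁ R₂
  have hR : 0 < R := hR₁.trans_le (le_max_left _ _)
  -- The two terms of the product rule: a differentiated cutoff times `φ - p`, and the cutoffs times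
  -- a first derivative of `φ - p`.
  set C := M₁ * M₂ * (2 * R) * (2 * R) + M₁ * M₂ * (2 * R)
  have hC : 0 ≤ C := by positivity
  obtain ⟨δ, hδ, hδε⟩ : ∃ δ > 0, C * δ ≤ ε :=
    ⟨ε / (C + 1), by positivity, by
      rw [mul_div_assoc', div_le_iff₀ (by positivity)]; nlinarith⟩
  obtain ⟨φxy, hmix⟩ := exists_hasMixedDeriv_of_contDiff hφ.1
  have hsep : (Algebra.adjoin ℝ {(⟨Prod.fst, continuous_fst⟩ : C(ℝ × ℝ, ℝ)),
      ⟨Prod.snd, continuous_snd⟩}).SeparatesPoints := by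
    intro p p' hne
    by_cases h : p.1 = p'.1
    · exact ⟨_, ⟨_, Algebra.subset_adjoin (Or.inr rfl), rfl⟩, fun h' => hne (Prod.ext h h')⟩
    · exact ⟨_, ⟨_, Algebra.subset_adjoin (Or.inl rfl), rfl⟩, h⟩
  -- Stone–Weierstrass is applied to the mixed derivative rather than to `φ`, so that integration
  -- controls the function and both first derivatives at once.
  obtain ⟨q, hq, hqnear⟩ :=
    ContinuousMap.exists_mem_subalgebra_near_continuous_of_isCompact_of_separatesPoints hsep φxy
      ((isCompact_Icc (a := -R) (b := R)).prod (isCompact_Icc (a := -R) (b := R))) hδ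
  obtain ⟨p, px, py, hp, hpx0, hpy0, ht⟩ := exists_hasMixedDeriv_of_mem_adjoin R hχ hη hq
  have hχR : χ (-R) = 0 := (hχ0 _ (by rw [abs_neg, abs_of_pos hR]; exact le_max_left _ _)).1
  have hηR : η (-R) = 0 := (hη0 _ (by rw [abs_neg, abs_of_pos hR]; exact le_max_right _ _)).1
  have hdiff := hmix.sub hp
  have hb := hdiff.abs_le hR.le hδ.le
    (fun y => by
      change φ (-R, y) - p (-R) y = 0
      rw [hφcut, hχR, hpx0]; ring)
    (fun x => by
      change φ (x, -R) - p x (-R) = 0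
      rw [hφcut, hηR, hpy0]; ring)
    (fun x hx y hy => by
      have := (hqnear (x, y) ⟨hx, hy⟩).le
      rwa [norm_sub_rev] at this)
  have hξ := isTestFunction_of_mem_tensorTest ht
  have hχd : ∀ x, HasDerivAt χ (deriv χ x) x := fun x => (hχ.differentiable x).hasDerivAt
  have hηd : ∀ x, HasDerivAt η (deriv η x) x := fun x => (hη.differentiable x).hasDerivAt
  have hbound : ∀ a b c d x y : ℝ, |a| ≤ M₁ → |b| ≤ M₂ → |c| ≤ M₁ → |d| ≤ M₂ →
      |x| ≤ δ * (2 * R) * (2 * R) → |y| ≤ δ * (2 * R) → |a * b * x + c * d * y| ≤ ε := by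
    intro a b c d x y ha hb hc hd hx hy
    calc |a * b * x + c * d * y| ≤ |a| * |b| * |x| + |c| * |d| * |y| := by
          rw [← abs_mul, ← abs_mul, ← abs_mul, ← abs_mul]; exact abs_add_le _ _
      _ ≤ M₁ * M₂ * (δ * (2 * R) * (2 * R)) + M₁ * M₂ * (δ * (2 * R)) := by gcongr
      _ = C * δ := by ring
      _ ≤ ε := hδε
  have hout : ∀ x, x ∉ Icc (-R) R → R ≤ |x| := fun x hx => by
    by_contra h
    have := abs_lt.1 (not_le.1 h)
    exact hx ⟨this.1.le, this.2.le⟩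
  refine ⟨_, ht, ?_⟩
  rintro ⟨x, y⟩
  have hx1 : fderiv ℝ φ (x, y) (1, 0) - fderiv ℝ
      (fun q : ℝ × ℝ => χ q.1 * η q.2 * p q.1 q.2) (x, y) (1, 0) =
      deriv χ x * η y * (φ (x, y) - p x y) +
        χ x * η y * (fderiv ℝ φ (x, y) (1, 0) - px x y) := by
    have h1 := (hasDerivAt_fst_of_differentiable hφ.differentiable x y).sub
      (hasDerivAt_fst_of_differentiable hξ.differentiable x y)
    have h2 := ((hχd x).mul_const (η y)).mul (hdiff.dx x y)
    -- Both sides are the derivative of the same function `χ η (φ - p)`, so uniqueness of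
    -- derivatives yields the formula.
    refine h1.unique (h2.congr_of_eventuallyEq (Eventually.of_forall fun t => ?_))
    have := hφcut t y
    simp only [Pi.sub_apply, Pi.mul_apply]
    linear_combination this
  have hy1 : fderiv ℝ φ (x, y) (0, 1) - fderiv ℝ
      (fun q : ℝ × ℝ => χ q.1 * η q.2 * p q.1 q.2) (x, y) (0, 1) =
      χ x * deriv η y * (φ (x, y) - p x y) +
        χ x * η y * (fderiv ℝ φ (x, y) (0, 1) - py x y) := by
    have h1 := (hasDerivAt_snd_of_differentiable hφ.differentiable x y).sub
      (hasDerivAt_snd_of_differentiable hξ.differentiable x y)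
    have h2 := ((hηd y).const_mul (χ x)).mul (hdiff.dy x y)
    refine h1.unique (h2.congr_of_eventuallyEq (Eventually.of_forall fun t => ?_))
    have := hφcut x t
    simp only [Pi.sub_apply, Pi.mul_apply]
    linear_combination this
  rw [hx1, hy1]
  by_cases hx : x ∈ Icc (-R) R
  · by_cases hy : y ∈ Icc (-R) R
    · obtain ⟨b0, b1, b2⟩ := hb x hx y hy
      exact ⟨hbound _ _ _ _ _ _ (hχb' x) (hηb y) (hχb x) (hηb y) b0 b1,
        hbound _ _ _ _ _ _ (hχb x) (hηb' y) (hχb x) (hηb y) b0 b2⟩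
    · obtain ⟨e1, e2⟩ := hη0 y ((le_max_right _ _).trans (hout y hy))
      simp [e1, e2, hε.le]
  · obtain ⟨e1, e2⟩ := hχ0 x ((le_max_left _ _).trans (hout x hx))
    simp [e1, e2, hε.le]

/-- A test function of one variable as an element of `H¹₀(A)`. -/
lemma exists_H10Line_of_isTestFunction {a : ℝ → ℝ} (ha : IsTestFunction A a) :
    ∃ r : H10Line A, (r : WithLp 2 (L2 A × L2 A)).fst =ᵐ[volume.restrict A] a ∧
      (r : WithLp 2 (L2 A × L2 A)).snd =ᵐ[volume.restrict A] deriv a := by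
  have h1 : MemLp a 2 (volume.restrict A) :=
    (ha.1.continuous.memLp_of_hasCompactSupport ha.2.1).restrict A
  have h2 : MemLp (deriv a) 2 (volume.restrict A) :=
    ((ha.1.continuous_deriv (by simp)).memLp_of_hasCompactSupport ha.2.1.deriv).restrict A
  exact ⟨⟨WithLp.toLp 2 (h1.toLp a, h2.toLp _), Submodule.le_topologicalClosure _
    ⟨a, ha, h1.coeFn_toLp, h2.coeFn_toLp⟩⟩, h1.coeFn_toLp, h2.coeFn_toLp⟩

/-- `U` represents the gradient of `φ`. -/
def RepresentsGrad {Ω : Set (ℝ × ℝ)} (U : WithLp 2 (L2 Ω × L2 Ω)) (φ : ℝ × ℝ → ℝ) : Prop :=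
  U.fst =ᵐ[volume.restrict Ω] (fun p => fderiv ℝ φ p (1, 0)) ∧
    U.snd =ᵐ[volume.restrict Ω] (fun p => fderiv ℝ φ p (0, 1))

lemma exists_tensor_representsGrad {a b : ℝ → ℝ} (ha : IsTestFunction A a)
    (hb : IsTestFunction B b) : ∃ (r : H10Line A) (s : H10Line B),
      RepresentsGrad (grad (A ×ˢ B) (tensor r s)) (fun p => a p.1 * b p.2) := by
  obtain ⟨r, hr, hr'⟩ := exists_H10Line_of_isTestFunction ha
  obtain ⟨s, hs, hs'⟩ := exists_H10Line_of_isTestFunction hb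
  have hd := (isTestFunction_tensor ha hb).differentiable
  have had : ∀ x, HasDerivAt a (deriv a x) x := fun x => (ha.differentiable x).hasDerivAt
  have hbd : ∀ x, HasDerivAt b (deriv b x) x := fun x => (hb.differentiable x).hasDerivAt
  refine ⟨r, s, ?_, ?_⟩
  · filter_upwards [coeFn_tensorL2 (r : WithLp 2 (L2 A × L2 A)).snd
      (s : WithLp 2 (L2 B × L2 B)).fst, ae_fst_prod hr', ae_snd_prod hs] with p h1 h2 h3
    refine h1.trans ?_
    rw [h2, h3]
    exact ((had p.1).mul_const _).unique (hasDerivAt_fst_of_differentiable hd p.1 p.2)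
  · filter_upwards [coeFn_tensorL2 (r : WithLp 2 (L2 A × L2 A)).fst
      (s : WithLp 2 (L2 B × L2 B)).snd, ae_fst_prod hr, ae_snd_prod hs'] with p h1 h2 h3
    refine h1.trans ?_
    rw [h2, h3]
    exact ((hbd p.2).const_mul _).unique (hasDerivAt_snd_of_differentiable hd p.1 p.2)

/-- An `L²` field orthogonal to all gradients of products is orthogonal to the gradients of sums
of products of test functions. -/
lemma exists_representsGrad_of_mem_tensorTest {w : WithLp 2 (L2 (A ×ˢ B) × L2 (A ×ˢ B))}
    (hw : ∀ (r : H10Line A) (s : H10Line B), inner ℝ w (grad (A ×ˢ B) (tensor r s)) = 0)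
    {ξ : ℝ → ℝ → ℝ} (hξ : ξ ∈ tensorTest A B) :
    ∃ U, RepresentsGrad U (fun p => ξ p.1 p.2) ∧ inner ℝ w U = 0 := by
  induction hξ using Submodule.span_induction with
  | mem u hu =>
    obtain ⟨a, b, ha, hb, rfl⟩ := hu
    obtain ⟨r, s, h⟩ := exists_tensor_representsGrad ha hb
    exact ⟨_, h, hw r s⟩
  | zero =>
    have h0 : ∀ p v, fderiv ℝ (fun q : ℝ × ℝ => (0 : ℝ → ℝ → ℝ) q.1 q.2) p v = 0 := fun p v => by
      simp
    refine ⟨0, ⟨?_, ?_⟩, inner_zero_right _⟩ <;>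
    · filter_upwards [Lp.coeFn_zero ℝ 2 (volume.restrict (A ×ˢ B))] with p hp
      rw [h0]; exact hp
  | add u v hu hv h₁ h₂ =>
    obtain ⟨U, ⟨h1, h2⟩, hU⟩ := h₁
    obtain ⟨V, ⟨k1, k2⟩, hV⟩ := h₂
    have hd : ∀ p, fderiv ℝ (fun q : ℝ × ℝ => (u + v) q.1 q.2) p =
        fderiv ℝ (fun q => u q.1 q.2) p + fderiv ℝ (fun q => v q.1 q.2) p := fun p =>
      fderiv_add ((isTestFunction_of_mem_tensorTest hu).differentiable p)
        ((isTestFunction_of_mem_tensorTest hv).differentiable p)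
    refine ⟨U + V, ⟨?_, ?_⟩, by rw [inner_add_right, hU, hV, add_zero]⟩
    · filter_upwards [h1, k1, Lp.coeFn_add U.fst V.fst] with p a b c
      exact c.trans (by rw [Pi.add_apply, a, b]; exact (DFunLike.congr_fun (hd p) (1, 0)).symm)
    · filter_upwards [h2, k2, Lp.coeFn_add U.snd V.snd] with p a b c
      exact c.trans (by rw [Pi.add_apply, a, b]; exact (DFunLike.congr_fun (hd p) (0, 1)).symm)
  | smul c u hu h =>
    obtain ⟨U, ⟨h1, h2⟩, hU⟩ := h
    have hd : ∀ p, fderiv ℝ (fun q : ℝ × ℝ => (c • u) q.1 q.2) p =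
        c • fderiv ℝ (fun q => u q.1 q.2) p := fun p =>
      fderiv_const_smul ((isTestFunction_of_mem_tensorTest hu).differentiable p) c
    refine ⟨c • U, ⟨?_, ?_⟩, by rw [inner_smul_right, hU, mul_zero]⟩
    · filter_upwards [h1, Lp.coeFn_smul c U.fst] with p a b
      exact b.trans (by rw [Pi.smul_apply, a]; exact (DFunLike.congr_fun (hd p) (1, 0)).symm)
    · filter_upwards [h2, Lp.coeFn_smul c U.snd] with p a b
      exact b.trans (by rw [Pi.smul_apply, a]; exact (DFunLike.congr_fun (hd p) (0, 1)).symm)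

/-- A field `w ∈ L²(A × B)²` orthogonal to the gradients of all products `r ⊗ s` is orthogonal to
all gradients: products are total in `H¹₀(A × B)`. -/
theorem inner_grad_eq_zero_of_forall_tensor (hA : IsOpen A) (hB : IsOpen B)
    (hbd : Bornology.IsBounded (A ×ˢ B)) {w : WithLp 2 (L2 (A ×ˢ B) × L2 (A ×ˢ B))}
    (hw : ∀ (r : H10Line A) (s : H10Line B), inner ℝ w (grad (A ×ˢ B) (tensor r s)) = 0)
    (u : H10 (A ×ˢ B)) : inner ℝ w (grad (A ×ˢ B) u) = 0 := by
  have : IsFiniteMeasure (volume.restrict (A ×ˢ B)) :=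
    isFiniteMeasure_restrict.2 hbd.measure_lt_top.ne
  let W := WithLp 2 (L2 (A ×ˢ B) × WithLp 2 (L2 (A ×ˢ B) × L2 (A ×ˢ B)))
  let g := WithLp.sndL 2 ℝ (L2 (A ×ˢ B)) (WithLp 2 (L2 (A ×ˢ B) × L2 (A ×ˢ B)))
  have hcl : IsClosed {U : W | inner ℝ w (g U) = 0} :=
    isClosed_eq (continuous_const.inner g.continuous) continuous_const
  have hmem : (u : W) ∈ closure (testGraph2 (A ×ˢ B) : Set W) := u.2
  refine closure_minimal (fun U hU => ?_) hcl hmem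
  obtain ⟨φ, hφ, -, h1, h2⟩ := hU
  change inner ℝ w U.snd = 0
  -- The square root of the area of `A ×ˢ B`, which converts uniform bounds into `L²` bounds.
  set m : ℝ := (measureUnivNNReal (volume.restrict (A ×ˢ B)) : ℝ) ^ (2 : ENNReal).toReal⁻¹
  have hm : 0 ≤ m := by positivity
  have key : ∀ ε > 0, |inner ℝ w U.snd| ≤ (‖w.fst‖ + ‖w.snd‖) * m * ε := by
    intro ε hε
    obtain ⟨ξ, hξ, hnear⟩ := exists_tensorTest_fderiv_near hA hB hφ hε
    obtain ⟨V, ⟨k1, k2⟩, hV⟩ := exists_representsGrad_of_mem_tensorTest hw hξ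
    have e1 : ‖U.snd.fst - V.fst‖ ≤ m * ε := by
      refine Lp.norm_le_of_ae_bound hε.le ?_
      filter_upwards [h1, k1, Lp.coeFn_sub U.snd.fst V.fst] with p a b c
      rw [c, Pi.sub_apply, a, b]
      exact (hnear p).1
    have e2 : ‖U.snd.snd - V.snd‖ ≤ m * ε := by
      refine Lp.norm_le_of_ae_bound hε.le ?_
      filter_upwards [h2, k2, Lp.coeFn_sub U.snd.snd V.snd] with p a b c
      rw [c, Pi.sub_apply, a, b]
      exact (hnear p).2
    have e3 : inner ℝ w U.snd =
        inner ℝ w.fst (U.snd.fst - V.fst) + inner ℝ w.snd (U.snd.snd - V.snd) := by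
      rw [← sub_zero (inner ℝ w U.snd), ← hV, ← inner_sub_right, WithLp.prod_inner_apply]
      rfl
    rw [e3]
    calc _ ≤ ‖w.fst‖ * (m * ε) + ‖w.snd‖ * (m * ε) :=
          (abs_add_le _ _).trans (add_le_add
            ((abs_real_inner_le_norm _ _).trans (mul_le_mul_of_nonneg_left e1 (norm_nonneg _)))
            ((abs_real_inner_le_norm _ _).trans (mul_le_mul_of_nonneg_left e2 (norm_nonneg _))))
      _ = _ := by ring
  refine abs_nonpos_iff.1 (le_of_forall_pos_le_add fun ε hε => ?_)
  set D := (‖w.fst‖ + ‖w.snd‖) * m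
  have hD : 0 ≤ D := by positivity
  refine (key (ε / (D + 1)) (by positivity)).trans ?_
  rw [zero_add, mul_div_assoc', div_le_iff₀ (by positivity)]
  nlinarith

end Density

/-- **Convergence of the pure greedy algorithm** for a form `⟨G u, G v⟩` with `G` bounded below,
and a dictionary `D` which is stable under scalar multiplication and total. -/
theorem tendsto_zero_of_greedy {V W : Type*} [NormedAddCommGroup V] [InnerProductSpace ℝ V]
    [CompleteSpace V] [NormedAddCommGroup W] [InnerProductSpace ℝ W] (G : V →L[ℝ] W) {C : ℝ}
    (hG : ∀ u, ‖u‖ ≤ C * ‖G u‖) {D : Set V} (hD : ∀ (c : ℝ), ∀ d ∈ D, c • d ∈ D)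
    (htotal : ∀ u, (∀ d ∈ D, inner ℝ (G u) (G d) = 0) → inner ℝ (G u) (G u) = 0)
    {g t : ℕ → V} (ht : ∀ n, t n ∈ D) (hg : ∀ n, g (n + 1) = g n - t n)
    (hmin : ∀ n, ∀ d ∈ D, (1 / 2) * ‖G (t n)‖ ^ 2 - inner ℝ (G (g n)) (G (t n)) ≤
      (1 / 2) * ‖G d‖ ^ 2 - inner ℝ (G (g n)) (G d)) :
    Tendsto g atTop (𝓝 0) := by
  have hmin' : ∀ n, ∀ d ∈ D, ∀ c : ℝ, (1 / 2) * ‖G (t n)‖ ^ 2 - inner ℝ (G (g n)) (G (t n)) ≤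
      (1 / 2) * ‖c • G d‖ ^ 2 - inner ℝ (G (g n)) (c • G d) := fun n d hd c => by
    rw [← map_smul]
    exact hmin n _ (hD c d hd)
  have hτ : ∀ n, inner ℝ (G (g n)) (G (t n)) = ‖G (t n)‖ ^ 2 := fun n =>
    (norm_sq_eq_of_isMinOn (ℓ := fun w => inner ℝ (G (g n)) w)
      (fun c => inner_smul_right _ _ _) (hmin' n _ (ht n))).symm
  have hγ : ∀ n, G (g (n + 1)) = G (g n) - G (t n) := fun n => by rw [hg, map_sub]
  have hle : ∀ n, ∀ d ∈ D, |inner ℝ (G (g n)) (G d)| ≤ ‖G (t n)‖ * ‖G d‖ := fun n d hd =>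
    abs_inner_le_of_isMinOn (hτ n) (hmin' n d hd)
  -- The steps themselves belong to the dictionary, so the greedy inequality applies to every pair
  -- of indices.
  have hcauchy := cauchySeq_of_greedy (γ := fun n => G (g n)) hγ hτ fun n k => hle n _ (ht k)
  have hcg : CauchySeq g := by
    -- The lower bound on `G` transfers the Cauchy property from `G (g n)` back to `g n`.
    have hlip : AntilipschitzWith C.toNNReal G :=
      AddMonoidHomClass.antilipschitz_of_bound G fun u => (hG u).trans
        (mul_le_mul_of_nonneg_right (Real.le_coe_toNNReal C) (norm_nonneg _))
    refine (hlip.isUniformInducing G.uniformContinuous).cauchy_map_iff.1 ?_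
    rw [Filter.map_map]
    exact hcauchy
  obtain ⟨x, hx⟩ := cauchySeq_tendsto_of_complete hcg
  have hGx : Tendsto (fun n => G (g n)) atTop (𝓝 (G x)) := (G.continuous.tendsto x).comp hx
  have h0 : G x = 0 := inner_self_eq_zero.1 (htotal x fun d hd =>
    inner_eq_zero_of_tendsto_of_greedy (summable_norm_sq_of_inner_eq hγ hτ) hGx
      fun n => hle n d hd)
  have hx0 : x = 0 := by
    have := hG x
    rw [h0, norm_zero, mul_zero] at this
    exact norm_le_zero_iff.1 this
  rwa [hx0] at hx

/-! ### The rank-one algorithm as a Hilbert space greedy algorithm -/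

section Algorithm

variable {A B : Set ℝ}

lemma tensorL2_smul_left (c : ℝ) (a : L2 A) (b : L2 B) :
    tensorL2 (c • a) b = c • tensorL2 a b := by
  apply Lp.ext
  filter_upwards [coeFn_tensorL2 (c • a) b, coeFn_tensorL2 a b,
    Lp.coeFn_smul c (tensorL2 a b), ae_fst_prod (Lp.coeFn_smul c a)] with p h1 h2 h4 h5
  simp only [h1, h4, Pi.smul_apply, h2, h5, smul_eq_mul]; ring

/-- Rank-one functions do not form a subspace in general, but scaling one factor shows that they are
stable under scalars, which is all the greedy argument asks of a dictionary. -/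
lemma tensor_smul_left (c : ℝ) (r : H10Line A) (s : H10Line B) :
    tensor (c • r) s = c • tensor r s := by
  apply Subtype.ext
  have hfst := tensorL2_smul_left c (H10Line.val r) (H10Line.val s)
  have hdx := tensorL2_smul_left c (H10Line.der r) (H10Line.val s)
  have hdy := tensorL2_smul_left c (H10Line.val r) (H10Line.der s)
  exact congrArg (WithLp.toLp 2) (Prod.ext hfst (congrArg (WithLp.toLp 2) (Prod.ext hdx hdy)))

/-- The load after `n` steps is `-Δ` of the residual `g - ∑ rₖ ⊗ sₖ`. -/
lemma load_eq_neg_laplacian {f : L2 (A ×ˢ B)} (r : ℕ → H10Line A) (s : ℕ → H10Line B)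
    {g : H10 (A ×ˢ B)} (hg : -laplacian g = ofL2 f) (n : ℕ) :
    load f r s n = -laplacian (g - ∑ k ∈ Finset.Icc 1 n, tensor (r k) (s k)) := by
  induction n with
  | zero => simpa [load] using hg.symm
  | succ n ih =>
    rw [load, ih, Finset.sum_Icc_succ_top (by omega), ← sub_sub, laplacian_sub _ (tensor _ _)]
    abel

lemma energy_neg_laplacian {Ω : Set (ℝ × ℝ)} (g u : H10 Ω) :
    energy (-laplacian g) u = (1 / 2) * ‖grad Ω u‖ ^ 2 - inner ℝ (grad Ω g) (grad Ω u) := by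
  have : (-laplacian g) u = inner ℝ (grad Ω g) (grad Ω u) := neg_neg _
  rw [energy, this]

/-- The Euler–Lagrange equations, tested with the solution itself. -/
lemma IsEulerLagrange.norm_sq_eq {F : Hneg (A ×ˢ B)} {r : H10Line A} {s : H10Line B}
    (h : IsEulerLagrange F r s) : ‖grad (A ×ˢ B) (tensor r s)‖ ^ 2 = F (tensor r s) := by
  have h0 : tensor (0 : H10Line A) s = 0 := by
    have := tensor_smul_left 0 (0 : H10Line A) s
    rwa [zero_smul, zero_smul] at this
  -- With a zero variation in the first factor, a single copy of `r ⊗ s` is left as test function.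
  have h1 := h 0 s
  rwa [h0, add_zero, real_inner_self_eq_norm_sq] at h1

theorem summable_norm_sq_of_isEulerLagrange (hbd : Bornology.IsBounded (A ×ˢ B))
    {f : L2 (A ×ˢ B)} {r : ℕ → H10Line A} {s : ℕ → H10Line B}
    (h : ∀ n, IsEulerLagrange (load f r s n) (r (n + 1)) (s (n + 1))) :
    Summable fun n => ‖grad (A ×ˢ B) (tensor (r (n + 1)) (s (n + 1)))‖ ^ 2 := by
  obtain ⟨g, hg⟩ := exists_neg_laplacian_eq hbd (ofL2 f)
  refine summable_norm_sq_of_inner_eq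
    (γ := fun n => grad (A ×ˢ B) (g - ∑ k ∈ Finset.Icc 1 n, tensor (r k) (s k)))
    (fun n => ?_) fun n => ?_
  · rw [← map_sub, sub_sub, Finset.sum_Icc_succ_top (by omega)]
  · rw [(h n).norm_sq_eq, load_eq_neg_laplacian r s hg]
    exact (neg_neg _).symm

set_option maxHeartbeats 1000000 in
theorem tendsto_residual_of_isRankOneMinimizer (hA : IsOpen A) (hB : IsOpen B)
    (hbd : Bornology.IsBounded (A ×ˢ B)) {f : L2 (A ×ˢ B)} {r : ℕ → H10Line A}
    {s : ℕ → H10Line B}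
    (h : ∀ n, IsRankOneMinimizer (load f r s n) (r (n + 1)) (s (n + 1)))
    {g : H10 (A ×ˢ B)} (hg : -laplacian g = ofL2 f) :
    Tendsto (fun n => g - ∑ k ∈ Finset.Icc 1 n, tensor (r k) (s k)) atTop (𝓝 0) := by
  obtain ⟨C, -, hC⟩ := exists_norm_le_mul_norm_grad hbd
  let D : Set (H10 (A ×ˢ B)) := {u | ∃ (r : H10Line A) (s : H10Line B), tensor r s = u}
  have hD : ∀ c : ℝ, ∀ d ∈ D, c • d ∈ D := by
    rintro c _ ⟨r, s, rfl⟩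
    exact ⟨c • r, s, tensor_smul_left c r s⟩
  refine tendsto_zero_of_greedy (V := H10 (A ×ˢ B)) (grad (A ×ˢ B)) hC (D := D) hD
    (fun u hu => inner_grad_eq_zero_of_forall_tensor hA hB hbd
      (fun r s => hu _ ⟨r, s, rfl⟩) u)
    (t := fun n => tensor (r (n + 1)) (s (n + 1))) (fun n => ⟨r (n + 1), s (n + 1), rfl⟩)
    (fun n => ?_) ?_
  · rw [sub_sub, Finset.sum_Icc_succ_top (by omega)]
  · rintro n _ ⟨r', s', rfl⟩
    have h1 := h n r' s'
    rwa [load_eq_neg_laplacian r s hg, energy_neg_laplacian, energy_neg_laplacian] at h1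

/-- The loads are `-Δ` of the residuals, and `Δ` is continuous from `H¹₀` to `H⁻¹`. -/
theorem tendsto_load_of_isRankOneMinimizer (hA : IsOpen A) (hB : IsOpen B)
    (hbd : Bornology.IsBounded (A ×ˢ B)) {f : L2 (A ×ˢ B)} {r : ℕ → H10Line A}
    {s : ℕ → H10Line B}
    (h : ∀ n, IsRankOneMinimizer (load f r s n) (r (n + 1)) (s (n + 1))) :
    Tendsto (load f r s) atTop (𝓝 0) := by
  obtain ⟨g, hg⟩ := exists_neg_laplacian_eq hbd (ofL2 f)
  have h1 := (continuous_laplacian.tendsto 0).comp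
    (tendsto_residual_of_isRankOneMinimizer hA hB hbd h hg)
  have h2 : laplacian (0 : H10 (A ×ˢ B)) = 0 := by
    rw [← sub_self (0 : H10 (A ×ˢ B)), laplacian_sub, sub_self]
  rw [h2] at h1
  have h3 := h1.neg
  rw [neg_zero] at h3
  exact h3.congr fun n => (load_eq_neg_laplacian r s hg n).symm

end Algorithm

end PureGreedy

open PureGreedy
theorem mainTheorem1 (Ωx Ωy : Set ℝ)
    (hxo : IsOpen Ωx) (hxc : IsConnected Ωx) (hxb : Bornology.IsBounded Ωx)
    (hyo : IsOpen Ωy) (hyc : IsConnected Ωy) (hyb : Bornology.IsBounded Ωy)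
    (f : L2 (Ωx ×ˢ Ωy)) (r : ℕ → H10Line Ωx) (s : ℕ → H10Line Ωy) :
    ((∀ n, IsEulerLagrange (load f r s n) (r (n + 1)) (s (n + 1))) →
      Summable (fun n => ‖grad (Ωx ×ˢ Ωy) (tensor (r (n + 1)) (s (n + 1)))‖ ^ 2) ∧
      Summable (fun n => energy (load f r s n) (tensor (r (n + 1)) (s (n + 1)))) ∧
      ∑' n, ‖grad (Ωx ×ˢ Ωy) (tensor (r (n + 1)) (s (n + 1)))‖ ^ 2 =
        -2 * ∑' n, energy (load f r s n) (tensor (r (n + 1)) (s (n + 1)))) ∧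
    ((∀ n, IsRankOneMinimizer (load f r s n) (r (n + 1)) (s (n + 1))) →
      (∀ g : H10 (Ωx ×ˢ Ωy), -laplacian g = ofL2 f →
        Tendsto (fun n => g - ∑ k ∈ Finset.Icc 1 n, tensor (r k) (s k)) atTop (𝓝 0)) ∧
      Tendsto (load f r s) atTop (𝓝 0)) := by
  have hbd : Bornology.IsBounded (Ωx ×ˢ Ωy) := hxb.prod hyb
  refine ⟨fun h => ?_, fun h => ⟨fun g hg =>
    tendsto_residual_of_isRankOneMinimizer hxo hyo hbd h hg,
    tendsto_load_of_isRankOneMinimizer hxo hyo hbd h⟩⟩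
  have hsum := summable_norm_sq_of_isEulerLagrange hbd h
  -- The Euler–Lagrange identity `‖∇t‖² = F t` turns the energy `½‖∇t‖² - F t` into `-½‖∇t‖²`.
  have he : (fun n => energy (load f r s n) (tensor (r (n + 1)) (s (n + 1)))) =
      fun n => (-1 / 2) * ‖grad (Ωx ×ˢ Ωy) (tensor (r (n + 1)) (s (n + 1)))‖ ^ 2 := by
    funext n
    rw [energy, ← (h n).norm_sq_eq]
    ring
  rw [he]
  refine ⟨hsum, hsum.mul_left _, ?_⟩
  rw [tsum_mul_left]
  ring
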